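/- Let $n$ be a natural number and let $\Gamma = G_1 * \cdots * G_n$ be a free product of groups. For a finite subset $A \subseteq \Gamma$ write $A^3 = \{abc : a,b,c \in A\}$, and let $\langle A\rangle$ be the subgroup of $\Gamma$ generated by $A$. A group is called virtually cyclic (virtually abelian, virtually nilpotent) if it has a subgroup of finite index that is cyclic (abelian, nilpotent); in particular, finite groups are virtually cyclic. (i) If every $G_i$ is virtually cyclic, then every finite subset $A \subseteq \Gamma$ such that $\langle A\rangle$ is not virtually cyclic satisfies $|A^3| \ge \frac{1}{7776}|A|^2$. (ii) If every $G_i$ is virtually abelian, then every finite subset $A \subseteq \Gamma$ such that $\langle A\rangle$ is not virtually abelian satisfies $|A^3| \ge \frac{1}{7776}|A|^2$. (iii) If every $G_i$ is virtually nilpotent, then every finite subset $A \subseteq \Gamma$ such that $\langle A\rangle$ is not virtually nilpotent satisfies $|A^3| \ge \frac{1}{7776}|A|^2$. -/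

import Mathlib

open scoped Pointwise

namespace Group

/-- A group is virtually cyclic if it has a cyclic subgroup of finite index
(in particular every finite group is virtually cyclic). -/
def IsVirtuallyCyclic (G : Type*) [Group G] : Prop :=
  ∃ N : Subgroup G, IsCyclic N ∧ N.FiniteIndex

/-- A group is virtually abelian if it has an abelian subgroup of finite index. -/
def IsVirtuallyAbelian (G : Type*) [Group G] : Prop :=
  ∃ N : Subgroup G, IsMulCommutative N ∧ N.FiniteIndex

end Group

/-! ### Geodesics and axes in trees -/

/-- An isometric action of a group on a simplicial tree, given by its vertices and the path metric,
without inversions and with trivial edge stabilizers. -/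
structure ArborealAction (G V : Type*) [Group G] [MulAction G V] where
  /-- the path metric -/
  dist : V → V → ℕ
  dist_self : ∀ u, dist u u = 0
  eq_of_dist_eq_zero : ∀ {u v}, dist u v = 0 → u = v
  dist_comm : ∀ u v, dist u v = dist v u
  dist_triangle : ∀ u v w, dist u w ≤ dist u v + dist v w
  four_point : ∀ u v w z,
    dist u v + dist w z ≤ max (dist u w + dist v z) (dist u z + dist v w)
  exists_step : ∀ u v, u ≠ v → ∃ w, dist u w = 1 ∧ dist w v + 1 = dist u v
  even_perimeter : ∀ u v w, Even (dist u v + dist v w + dist u w)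
  dist_smul : ∀ (g : G) u v, dist (g • u) (g • v) = dist u v
  even_displacement : ∀ (g : G) u, Even (dist u (g • u))
  edge_stabilizer : ∀ (g : G) u v, dist u v = 1 → g • u = u → g • v = v → g = 1

namespace ArborealAction

variable {G V : Type*} [Group G] [MulAction G V] (T : ArborealAction G V)

/-- `v` lies on the geodesic from `u` to `w`. -/
def Btw (u v w : V) : Prop := T.dist u v + T.dist v w = T.dist u w

theorem dist_pos {u v : V} (h : u ≠ v) : 0 < T.dist u v :=
  Nat.pos_of_ne_zero fun h0 => h (T.eq_of_dist_eq_zero h0)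

theorem dist_smul_right (g : G) (u v : V) : T.dist u (g • v) = T.dist (g⁻¹ • u) v := by
  rw [← T.dist_smul g _ v, smul_inv_smul]

variable {T}

theorem Btw.symm {u v w : V} (h : T.Btw u v w) : T.Btw w v u := by
  unfold Btw at *
  rw [T.dist_comm w v, T.dist_comm v u, T.dist_comm w u, ← h, add_comm]

theorem Btw.smul {u v w : V} (h : T.Btw u v w) (g : G) : T.Btw (g • u) (g • v) (g • w) := by
  simpa only [Btw, T.dist_smul] using h

/-- In a tree, geodesics that overlap in a nontrivial segment concatenate to a geodesic. -/
theorem Btw.concat {u v w z : V} (h : T.Btw u v w) (h' : T.Btw v w z) (hvw : v ≠ w) :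
    T.dist u z = T.dist u v + T.dist v w + T.dist w z := by
  have h0 := T.dist_pos hvw
  have h1 := T.four_point u w v z
  have h2 := T.dist_triangle u v z
  have h3 := T.dist_comm w v
  unfold Btw at *
  omega

/-- An endpoint moved by less than its distance to `m` stays in the same branch at `m`. -/
theorem Btw.shift {p m q p' : V} (h : T.Btw p m q) (hp : T.dist p p' < T.dist p m) :
    T.Btw p' m q := by
  have h1 := T.four_point p q p' m
  have h2 := T.dist_triangle p' m q
  have h3 := T.dist_comm p' q
  have h4 := T.dist_comm q m
  have h5 := T.dist_comm p' m
  unfold Btw at *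
  omega

variable (T)

theorem exists_point (u v : V) (k : ℕ) (hk : k ≤ T.dist u v) :
    ∃ w, T.dist u w = k ∧ T.dist w v + k = T.dist u v := by
  induction k with
  | zero => exact ⟨u, T.dist_self u, rfl⟩
  | succ k ih =>
    obtain ⟨w, h1, h2⟩ := ih (by omega)
    obtain ⟨w', h3, h4⟩ := T.exists_step w v (by
      rintro rfl
      rw [T.dist_self] at h2; omega)
    have h5 := T.dist_triangle u w w'
    have h6 := T.dist_triangle u w' v
    exact ⟨w', by omega, by omega⟩

theorem point_unique {u v w w' : V} (h : T.Btw u w v) (h' : T.Btw u w' v)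
    (hd : T.dist u w = T.dist u w') : w = w' := by
  apply T.eq_of_dist_eq_zero
  have h1 := T.four_point u v w w'
  have h2 := T.dist_comm v w
  have h3 := T.dist_comm v w'
  unfold Btw at *
  omega

theorem exists_path (u v : V) : ∃ s : ℕ → V, s 0 = u ∧ s (T.dist u v) = v ∧
    ∀ i j, i ≤ j → j ≤ T.dist u v → T.dist (s i) (s j) = j - i := by
  have : Nonempty V := ⟨u⟩
  choose! s h1 h2 using fun k hk => T.exists_point u v k hk
  refine ⟨s, ?_, ?_, ?_⟩
  · exact (T.eq_of_dist_eq_zero (h1 0 (Nat.zero_le _))).symm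
  · have := h2 _ le_rfl
    exact T.eq_of_dist_eq_zero (by omega)
  · intro i j hij hj
    have a1 := h1 i (by omega)
    have a2 := h2 i (by omega)
    have b1 := h1 j hj
    have b2 := h2 j hj
    have h3 := T.dist_triangle u (s i) (s j)
    have h4 := T.four_point u v (s i) (s j)
    have h5 := T.dist_comm v (s i)
    have h6 := T.dist_comm v (s j)
    omega

/-- An element fixing two distinct points is trivial. -/
theorem eq_one_of_fix (T : ArborealAction G V) {g : G} {u v : V} (huv : u ≠ v) (hu : g • u = u) (hv : g • v = v) :
    g = 1 := by
  obtain ⟨w, h1, h2⟩ := T.exists_step u v huv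
  refine T.edge_stabilizer g u w h1 hu ?_
  have hb : T.Btw u w v := by unfold Btw; omega
  have hb' := hb.smul g
  rw [hu, hv] at hb'
  refine T.point_unique hb' hb ?_
  rw [← T.dist_smul g u w, hu]

theorem eq_of_smul_eq (T : ArborealAction G V) {g k : G} {u v : V} (huv : u ≠ v) (hu : g • u = k • u)
    (hv : g • v = k • v) : g = k := by
  have := T.eq_one_of_fix (g := k⁻¹ * g) huv (by rw [mul_smul, hu, inv_smul_smul])
    (by rw [mul_smul, hv, inv_smul_smul])
  exact (inv_mul_eq_one.mp this).symm

/-- The theorem of Fine and Wilf, for two elements translating along a common segment. -/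
theorem exists_common_root (n : ℕ) : ∀ (s : ℕ → V) (D κ l : ℕ) (k k' : G), κ + l = n →
    (∀ i j, i ≤ j → j ≤ D → T.dist (s i) (s j) = j - i) → 0 < κ → 0 < l → κ + l < D →
    (∀ i, i + κ ≤ D → k • s i = s (i + κ)) → (∀ i, i + l ≤ D → k' • s i = s (i + l)) →
    ∃ (r : G) (i j : ℕ), k = r ^ i ∧ k' = r ^ j ∧ i * l = j * κ := by
  induction n using Nat.strong_induction_on with
  | _ n ih =>
    have main : ∀ (s : ℕ → V) (D κ l : ℕ) (k k' : G), κ + l = n → κ ≤ l →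
        (∀ i j, i ≤ j → j ≤ D → T.dist (s i) (s j) = j - i) → 0 < κ → 0 < l → κ + l < D →
        (∀ i, i + κ ≤ D → k • s i = s (i + κ)) → (∀ i, i + l ≤ D → k' • s i = s (i + l)) →
        ∃ (r : G) (i j : ℕ), k = r ^ i ∧ k' = r ^ j ∧ i * l = j * κ := by
      intro s D κ l k k' hn hle hs hκ hl hD hk hk'
      rcases hle.eq_or_lt with rfl | hlt
      · refine ⟨k, 1, 1, by simp, ?_, rfl⟩
        rw [pow_one]
        have h01 : s 0 ≠ s 1 := by
          intro h
          have := hs 0 1 (by omega) (by omega)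
          rw [h, T.dist_self] at this
          omega
        refine T.eq_of_smul_eq h01 ?_ ?_
        · rw [hk 0 (by omega), hk' 0 (by omega)]
        · rw [hk 1 (by omega), hk' 1 (by omega)]
      -- Euclid's algorithm: `k⁻¹ * k'` translates by `l - κ` along the segment shortened by `κ`,
      -- and `κ + l < D` is exactly what the smaller instance needs.
      · obtain ⟨r, i, j, h1, h2, h3⟩ := ih l (by omega) s (D - κ) κ (l - κ) k (k⁻¹ * k')
          (by omega) (fun i j hij hj => hs i j hij (by omega)) hκ (by omega) (by omega)
          (fun i hi => hk i (by omega)) (fun i hi => by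
            rw [mul_smul, hk' i (by omega), inv_smul_eq_iff, hk _ (by omega)]
            congr 1; omega)
        refine ⟨r, i, i + j, h1, ?_, ?_⟩
        · rw [pow_add, ← h1, ← h2, mul_inv_cancel_left]
        · obtain ⟨c, rfl⟩ := Nat.exists_eq_add_of_le hlt.le
          rw [Nat.add_sub_cancel_left] at h3
          rw [mul_add, add_mul, h3]
    intro s D κ l k k' hn hs hκ hl hD hk hk'
    rcases le_total κ l with h | h
    · exact main s D κ l k k' hn h hs hκ hl hD hk hk'
    · obtain ⟨r, i, j, h1, h2, h3⟩ :=
        main s D l κ k' k (by omega) h hs hl hκ (by omega) hk' hk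
      exact ⟨r, j, i, h2, h1, h3.symm⟩

theorem pow_eq_pow_of_translates {s : ℕ → V} {D κ l : ℕ} {k k' : G}
    (hs : ∀ i j, i ≤ j → j ≤ D → T.dist (s i) (s j) = j - i) (hκ : 0 < κ) (hl : 0 < l)
    (hD : κ + l < D) (hk : ∀ i, i + κ ≤ D → k • s i = s (i + κ))
    (hk' : ∀ i, i + l ≤ D → k' • s i = s (i + l)) : k ^ l = k' ^ κ := by
  obtain ⟨r, i, j, rfl, rfl, h⟩ := T.exists_common_root _ s D κ l k k' rfl hs hκ hl hD hk hk'
  rw [← pow_mul, ← pow_mul, h]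

/-- A bi-infinite geodesic translated by `κ` under `h`. -/
structure Axis (h : G) (κ : ℕ) (ℓ : ℤ → V) : Prop where
  pos : 0 < κ
  dist : ∀ i j, T.dist (ℓ i) (ℓ j) = (i - j).natAbs
  smul : ∀ i, h • ℓ i = ℓ (i + κ)

variable {T}

theorem dist_of_local {f : ℤ → V} (h1 : ∀ i, T.dist (f i) (f (i + 1)) = 1)
    (h2 : ∀ i, T.dist (f i) (f (i + 2)) = 2) (i j : ℤ) :
    T.dist (f i) (f j) = (i - j).natAbs := by
  have key : ∀ (i : ℤ) (n : ℕ), T.dist (f i) (f (i + n)) = n ∧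
      T.dist (f i) (f (i + n + 1)) = n + 1 := by
    intro i n
    induction n with
    | zero => simpa [T.dist_self] using h1 i
    | succ n ih =>
      obtain ⟨a, b⟩ := ih
      refine ⟨by push_cast; rw [← add_assoc]; exact b, ?_⟩
      have hb1 : T.Btw (f i) (f (i + n)) (f (i + n + 1)) := by
        unfold Btw; rw [a, b, h1]
      have hb2 : T.Btw (f (i + n)) (f (i + n + 1)) (f (i + n + 1 + 1)) := by
        unfold Btw; rw [h1, h1, add_assoc (i + n : ℤ) 1 1]; exact (h2 _).symm
      have := hb1.concat hb2 (by
        intro h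
        have := h1 (i + n)
        rw [← h, T.dist_self] at this
        omega)
      push_cast
      rw [← add_assoc, this, a, h1, h1]
  rcases le_total i j with h | h
  · obtain ⟨n, rfl⟩ := Int.le.dest h
    rw [(key i n).1]; omega
  · obtain ⟨n, rfl⟩ := Int.le.dest h
    rw [T.dist_comm, (key j n).1]; omega

/-- The translates of one period of `s` by powers of `h` are glued end to end. The extra step `0 <
D` beyond the period excludes folding at the joints, and by `dist_of_local` local geodesics are
geodesics. -/
theorem exists_axis {s : ℕ → V} {D κ : ℕ} {h : G}
    (hs : ∀ i j, i ≤ j → j ≤ D + κ → T.dist (s i) (s j) = j - i) (hκ : 0 < κ) (hD : 0 < D)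
    (hh : ∀ i, i ≤ D → h • s i = s (i + κ)) :
    ∃ ℓ : ℤ → V, T.Axis h κ ℓ ∧ ∀ i : ℕ, i ≤ D + κ → ℓ i = s i := by
  set ℓ : ℤ → V := fun i => h ^ (i / κ) • s (i % κ).toNat with hℓ
  have hκ0 : (κ : ℤ) ≠ 0 := by omega
  have hsm : ∀ i, h • ℓ i = ℓ (i + κ) := by
    intro i
    simp only [hℓ]
    rw [Int.add_ediv_of_dvd_right (dvd_refl _), Int.ediv_self hκ0, Int.add_emod_right, zpow_add,
      zpow_one, ← mul_smul]
    congr 1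
    exact (Commute.refl h).zpow_right _ |>.eq
  have hsmn : ∀ (n : ℤ) i, h ^ n • ℓ i = ℓ (i + n * κ) := by
    intro n i
    simp only [hℓ]
    rw [Int.add_mul_ediv_right _ _ hκ0, Int.add_mul_emod_self_right, ← mul_smul, ← zpow_add,
      add_comm]
  have heq : ∀ i : ℕ, i ≤ D + κ → ℓ i = s i := by
    intro i
    induction i using Nat.strong_induction_on with
    | _ i ih =>
      intro hi
      by_cases hlt : i < κ
      · have : (i : ℤ) / κ = 0 := Int.ediv_eq_zero_of_lt (by omega) (by omega)
        have h2 : (i : ℤ) % κ = i := Int.emod_eq_of_lt (by omega) (by omega)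
        simp only [hℓ, this, h2, zpow_zero, one_smul, Int.toNat_natCast]
      · obtain ⟨c, rfl⟩ := Nat.exists_eq_add_of_le (not_lt.mp hlt)
        have := ih c (by omega) (by omega)
        rw [add_comm κ c, ← hh c (by omega), ← this, hsm]
        push_cast; rfl
  refine ⟨ℓ, ⟨hκ, ?_, hsm⟩, heq⟩
  have key : ∀ (i : ℤ) (m : ℕ), m ≤ 2 → T.dist (ℓ i) (ℓ (i + m)) = m := by
    intro i m hm
    have e1 := hsmn (i / κ) (i % κ)
    have e2 := hsmn (i / κ) (i % κ + m)
    have e3 : i % κ + i / κ * κ = i := by rw [mul_comm]; exact Int.emod_add_mul_ediv i κ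
    rw [e3] at e1
    rw [add_right_comm, e3] at e2
    have e4 := Int.emod_nonneg i hκ0
    have e5 := Int.emod_lt_of_pos i (b := κ) (by omega)
    rw [← e1, ← e2, T.dist_smul]
    obtain ⟨c, hc⟩ := Int.eq_ofNat_of_zero_le e4
    rw [hc] at e5 ⊢
    have := heq (c + m) (by omega)
    push_cast at this
    rw [heq c (by omega), this, hs _ _ (by omega) (by omega)]
    omega
  exact dist_of_local (fun i => key i 1 (by omega)) (fun i => key i 2 (by omega))

theorem Axis.zpow {h : G} {κ : ℕ} {ℓ : ℤ → V} (a : T.Axis h κ ℓ) (n i : ℤ) :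
    h ^ n • ℓ i = ℓ (i + n * κ) := by
  induction n using Int.induction_on generalizing i with
  | zero => simp
  | succ n ih => rw [zpow_add_one, mul_smul, a.smul, ih]; congr 1; ring
  | pred n ih =>
    rw [zpow_sub_one, mul_smul]
    have : h⁻¹ • ℓ i = ℓ (i - κ) := by rw [inv_smul_eq_iff, a.smul]; congr 1; ring
    rw [this, ih]; congr 1; ring

theorem Axis.injective {h : G} {κ : ℕ} {ℓ : ℤ → V} (a : T.Axis h κ ℓ) :
    Function.Injective ℓ := by
  intro i j hij
  have := a.dist i j
  rw [hij, T.dist_self] at this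
  omega

theorem Axis.btw {h : G} {κ : ℕ} {ℓ : ℤ → V} (a : T.Axis h κ ℓ) {i j k : ℤ}
    (hijk : i ≤ j ∧ j ≤ k ∨ k ≤ j ∧ j ≤ i) : T.Btw (ℓ i) (ℓ j) (ℓ k) := by
  unfold Btw
  rw [a.dist, a.dist, a.dist]
  omega

theorem Axis.eq_of_btw {h : G} {κ : ℕ} {ℓ : ℤ → V} (a : T.Axis h κ ℓ) {i j : ℤ} {v : V}
    (hb : T.Btw (ℓ i) v (ℓ j)) : ∃ k, v = ℓ k := by
  have h1 := hb
  unfold Btw at h1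
  rw [a.dist] at h1
  rcases le_total i j with h | h
  · refine ⟨i + T.dist (ℓ i) v, T.point_unique hb (a.btw (by omega)) ?_⟩
    rw [a.dist]; omega
  · refine ⟨i - T.dist (ℓ i) v, T.point_unique hb (a.btw (by omega)) ?_⟩
    rw [a.dist]; omega

/-- Two axes through a common point, of elements with a common power, coincide. -/
theorem Axis.eq_of_pow_eq {h h' : G} {κ κ' : ℕ} {ℓ ℓ' : ℤ → V} (a : T.Axis h κ ℓ)
    (a' : T.Axis h' κ' ℓ') (hpow : h ^ κ' = h' ^ κ) (h0 : ℓ 0 = ℓ' 0) : ℓ = ℓ' := by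
  have hN : ∀ n : ℤ, ℓ (n * (κ' * κ)) = ℓ' (n * (κ' * κ)) := by
    intro n
    have e1 := a.zpow (κ' * n) 0
    have e2 := a'.zpow (κ * n) 0
    rw [zpow_mul, zpow_natCast, hpow, ← zpow_natCast, ← zpow_mul, h0, e2] at e1
    rw [show n * (κ' * κ : ℤ) = 0 + κ' * n * κ by ring, ← e1]
    congr 1; ring
  have hpos : (1 : ℤ) ≤ κ' * κ := by
    have := Nat.mul_pos a'.pos a.pos
    exact_mod_cast this
  funext i
  have hNi := hN i
  have hi : 0 ≤ i ∧ i ≤ i * (κ' * κ) ∨ i * (κ' * κ) ≤ i ∧ i ≤ 0 := by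
    rcases le_total 0 i with h | h
    · left; exact ⟨h, by nlinarith⟩
    · right; exact ⟨by nlinarith, h⟩
  have b1 : T.Btw (ℓ 0) (ℓ i) (ℓ (i * (κ' * κ))) := a.btw (by omega)
  have b2 : T.Btw (ℓ' 0) (ℓ' i) (ℓ' (i * (κ' * κ))) := a'.btw (by omega)
  rw [← h0, ← hNi] at b2
  refine T.point_unique b1 b2 ?_
  rw [a.dist, h0, a'.dist]

end ArborealAction

/-! ### Coincidences among products without cancellation -/

namespace ArborealAction

variable {G V : Type*} [Group G] [MulAction G V] (T : ArborealAction G V)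

/-- Products `a * x * b` with `a ∈ P` and `b ∈ Q` have no cancellation as seen from `o`. -/
structure Aligned (o : V) (P Q : Finset G) (x : G) : Prop where
  ne : o ≠ x • o
  left : ∀ a ∈ P, T.Btw (a⁻¹ • o) o (x • o)
  right : ∀ b ∈ Q, T.Btw (x⁻¹ • o) o (b • o)

/-- A coincidence `a₁ * x * b₁ = a₂ * x * b₂` with `a₁⁻¹ * a₂ = h`, in which the two occurrences
of `x` are offset by a positive `κ` less than half the length of `x`. -/
def Overlap (o : V) (P Q : Finset G) (x : G) (κ : ℕ) (h : G) : Prop :=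
  ∃ a₁ ∈ P, ∃ a₂ ∈ P, ∃ b₁ ∈ Q, ∃ b₂ ∈ Q, a₁ * x * b₁ = a₂ * x * b₂ ∧
    T.dist o (a₂ • o) = T.dist o (a₁ • o) + κ ∧ 0 < κ ∧ 2 * κ < T.dist o (x • o) ∧ h = a₁⁻¹ * a₂

variable {T}

theorem dist_inv (o : V) (g : G) : T.dist o (g⁻¹ • o) = T.dist o (g • o) := by
  rw [T.dist_smul_right, inv_inv, T.dist_comm]

theorem dist_smul_mul_smul (o : V) (a x : G) :
    T.dist (a • o) ((a * x) • o) = T.dist o (x • o) := by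
  rw [mul_smul, T.dist_smul]

theorem Aligned.mono {o : V} {P Q P' Q' : Finset G} {x : G} (h : T.Aligned o P Q x)
    (hP : P' ⊆ P) (hQ : Q' ⊆ Q) : T.Aligned o P' Q' x :=
  ⟨h.ne, fun a ha => h.left a (hP ha), fun b hb => h.right b (hQ hb)⟩

theorem Overlap.mono {o : V} {P Q P' Q' : Finset G} {x h : G} {κ : ℕ}
    (ho : T.Overlap o P' Q' x κ h) (hP : P' ⊆ P) (hQ : Q' ⊆ Q) : T.Overlap o P Q x κ h := by
  obtain ⟨a₁, ha₁, a₂, ha₂, b₁, hb₁, b₂, hb₂, r⟩ := ho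
  exact ⟨a₁, hP ha₁, a₂, hP ha₂, b₁, hQ hb₁, b₂, hQ hb₂, r⟩

section

variable {o : V} {P Q : Finset G} {x : G} (hal : T.Aligned o P Q x)

include hal

theorem Aligned.btw_left {a : G} (ha : a ∈ P) : T.Btw o (a • o) ((a * x) • o) := by
  have := (hal.left a ha).smul a
  rwa [smul_inv_smul, ← mul_smul] at this

theorem Aligned.btw_right {b : G} (hb : b ∈ Q) (a : G) :
    T.Btw (a • o) ((a * x) • o) ((a * x * b) • o) := by
  have := (hal.right b hb).smul (a * x)
  rwa [← mul_smul, mul_inv_cancel_right, ← mul_smul] at this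

theorem Aligned.smul_ne (a : G) : a • o ≠ (a * x) • o := by
  intro h
  rw [mul_smul] at h
  exact hal.ne (smul_left_cancel a h)

theorem Aligned.dist_mul_mul {a b : G} (ha : a ∈ P) (hb : b ∈ Q) :
    T.dist o ((a * x * b) • o) =
      T.dist o (a • o) + T.dist o (x • o) + T.dist o (b • o) := by
  rw [(hal.btw_left ha).concat (hal.btw_right hb a) (hal.smul_ne a), dist_smul_mul_smul,
    mul_smul (a * x) b, T.dist_smul]

theorem Aligned.btw_left' {a b : G} (ha : a ∈ P) (hb : b ∈ Q) :
    T.Btw o (a • o) ((a * x * b) • o) := by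
  have h1 := (hal.btw_left ha).concat (hal.btw_right hb a) (hal.smul_ne a)
  have h2 := hal.btw_right hb a
  unfold Btw at *
  omega

theorem Aligned.btw_right' {a b : G} (ha : a ∈ P) (hb : b ∈ Q) :
    T.Btw o ((a * x) • o) ((a * x * b) • o) := by
  have h1 := (hal.btw_left ha).concat (hal.btw_right hb a) (hal.smul_ne a)
  have h2 := hal.btw_left ha
  unfold Btw at *
  omega

theorem Aligned.dist_left {a : G} (ha : a ∈ P) :
    T.dist o ((a * x) • o) = T.dist o (a • o) + T.dist o (x • o) := by
  rw [← hal.btw_left ha, dist_smul_mul_smul]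

/-- Equal products with equally long left factors have equal factors. -/
theorem Aligned.eq_of_dist_eq {a₁ a₂ b₁ b₂ : G} (ha₁ : a₁ ∈ P) (ha₂ : a₂ ∈ P) (hb₁ : b₁ ∈ Q)
    (hb₂ : b₂ ∈ Q) (he : a₁ * x * b₁ = a₂ * x * b₂)
    (hd : T.dist o (a₁ • o) = T.dist o (a₂ • o)) : a₁ = a₂ ∧ b₁ = b₂ := by
  have e1 : a₁ • o = a₂ • o := by
    refine T.point_unique (hal.btw_left' ha₁ hb₁) ?_ hd
    rw [he]; exact hal.btw_left' ha₂ hb₂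
  have e2 : (a₁ * x) • o = (a₂ * x) • o := by
    refine T.point_unique (hal.btw_right' ha₁ hb₁) ?_ ?_
    · rw [he]; exact hal.btw_right' ha₂ hb₂
    · rw [hal.dist_left ha₁, hal.dist_left ha₂, hd]
  have : a₁ = a₂ := T.eq_of_smul_eq hal.ne e1 (by rwa [← mul_smul, ← mul_smul])
  subst this
  exact ⟨rfl, mul_left_cancel he⟩

/-- Within a fibre, the length of `a` determines the pair. These lengths lie in `[0, L]`, where `L`
is the length of `x`. They fall into three windows of width `L / 2`, and two different lengths in
one window would form an overlap. -/
theorem Aligned.card_mul_card_le [DecidableEq G] (hlen : ∀ a ∈ P, T.dist o (a • o) ≤ T.dist o (x • o))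
    (hno : ∀ κ h, ¬ T.Overlap o P Q x κ h) :
    P.card * Q.card ≤ 3 * ((P ×ˢ Q).image fun p => p.1 * x * p.2).card := by
  rw [← Finset.card_product]
  refine Finset.card_le_mul_card_image _ 3 fun g _ => ?_
  have hL := T.dist_pos hal.ne
  rw [← Finset.card_range 3]
  refine Finset.card_le_card_of_injOn (fun p => 2 * T.dist o (p.1 • o) / T.dist o (x • o)) ?_ ?_
  · intro p hp
    simp only [Finset.coe_filter, Finset.mem_product, Set.mem_ofPred_eq] at hp
    simp only [Finset.coe_range, Set.mem_Iio]
    rw [Nat.div_lt_iff_lt_mul hL]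
    have := hlen _ hp.1.1
    omega
  · have key : ∀ a₁ ∈ P, ∀ a₂ ∈ P, ∀ b₁ ∈ Q, ∀ b₂ ∈ Q, a₁ * x * b₁ = a₂ * x * b₂ →
        2 * T.dist o (a₁ • o) / T.dist o (x • o) = 2 * T.dist o (a₂ • o) / T.dist o (x • o) →
        T.dist o (a₂ • o) ≤ T.dist o (a₁ • o) := by
      intro a₁ ha₁ a₂ ha₂ b₁ hb₁ b₂ hb₂ he hq
      by_contra! hlt
      refine hno (T.dist o (a₂ • o) - T.dist o (a₁ • o)) (a₁⁻¹ * a₂)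
        ⟨a₁, ha₁, a₂, ha₂, b₁, hb₁, b₂, hb₂, he, by omega, by omega, ?_, rfl⟩
      by_contra! hle
      have : 2 * T.dist o (a₁ • o) / T.dist o (x • o) + 1 ≤
          2 * T.dist o (a₂ • o) / T.dist o (x • o) := by
        rw [← Nat.add_div_right _ hL]
        exact Nat.div_le_div_right (by omega)
      omega
    rintro ⟨a₁, b₁⟩ hp ⟨a₂, b₂⟩ hq heq
    simp only [Finset.coe_filter, Finset.mem_product, Set.mem_ofPred_eq] at hp hq heq
    have h1 := key a₁ hp.1.1 a₂ hq.1.1 b₁ hp.1.2 b₂ hq.1.2 (hp.2.trans hq.2.symm) heq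
    have h2 := key a₂ hq.1.1 a₁ hp.1.1 b₂ hq.1.2 b₁ hp.1.2 (hq.2.trans hp.2.symm) heq.symm
    obtain ⟨rfl, rfl⟩ := hal.eq_of_dist_eq hp.1.1 hq.1.1 hp.1.2 hq.1.2 (hp.2.trans hq.2.symm)
      (le_antisymm h2 h1)
    rfl

/-- Both occurrences of `x` lie on the geodesic from `o` to the common product, offset by `κ`.
Pulled back by `a₁`, this says that `h` shifts the segment from `o` to `x • o` along itself by `κ`.
-/
theorem Aligned.exists_axis {κ : ℕ} {h : G} (hov : T.Overlap o P Q x κ h) :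
    ∃ ℓ : ℤ → V, T.Axis h κ ℓ ∧ ℓ 0 = o ∧ ℓ (T.dist o (x • o)) = x • o := by
  obtain ⟨a₁, ha₁, a₂, ha₂, b₁, hb₁, b₂, hb₂, he, hd, hκ, h2κ, rfl⟩ := hov
  set L := T.dist o (x • o) with hL
  have hd1 := hal.dist_mul_mul ha₁ hb₁
  have hd2 := hal.dist_mul_mul ha₂ hb₂
  rw [← hL] at hd1 hd2
  rw [he] at hd1
  obtain ⟨s, hs0, hs1, hs⟩ := T.exists_path o ((a₁ * x * b₁) • o)
  rw [he, hd2] at hs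
  rw [he, hd2] at hs1
  have hpt : ∀ v, T.Btw o v ((a₁ * x * b₁) • o) → ∀ k, T.dist o v = k → s k = v := by
    rintro v hv k rfl
    have hle : T.dist o v ≤ T.dist o (a₂ • o) + L + T.dist o (b₂ • o) := by
      rw [he] at hv; unfold Btw at hv; omega
    rw [he] at hv
    have e1 := hs _ _ (Nat.zero_le _) hle
    have e2 := hs _ _ hle le_rfl
    rw [hs0] at e1
    rw [hs1] at e2
    refine T.point_unique ?_ hv ?_
    · unfold Btw
      rw [e1, e2, hd2]; omega
    · rw [e1]; omega
  have p1 := hpt _ (hal.btw_left' ha₁ hb₁) _ rfl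
  have p2 := hpt _ (hal.btw_right' ha₁ hb₁) _ (hal.dist_left ha₁)
  have p3 := hpt _ (by rw [he]; exact hal.btw_left' ha₂ hb₂) _ rfl
  have p4 := hpt _ (by rw [he]; exact hal.btw_right' ha₂ hb₂) _ (hal.dist_left ha₂)
  rw [hd] at p3
  rw [hd, ← hL] at p4
  rw [← hL] at p2
  set α := T.dist o (a₁ • o) with hα
  have hb : T.dist o (b₁ • o) = T.dist o (b₂ • o) + κ := by omega
  obtain ⟨ℓ, hℓ, hℓs⟩ := ArborealAction.exists_axis (T := T) (s := fun i => a₁⁻¹ • s (α + i))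
    (D := L) (κ := κ) (h := a₁⁻¹ * a₂)
    (fun i j hij hj => by
      rw [T.dist_smul, hs _ _ (by omega) (by omega)]; omega) hκ (by omega)
    (fun i hi => by
      rw [← mul_smul, mul_assoc, mul_smul, smul_left_cancel_iff, mul_smul, smul_eq_iff_eq_inv_smul]
      have h1 : T.Btw (a₁ • o) (s (α + i)) ((a₁ * x) • o) := by
        unfold Btw
        rw [← p1, ← p2, hs _ _ (by omega) (by omega), hs _ _ (by omega) (by omega),
          hs _ _ (by omega) (by omega)]
        omega
      have h2 : T.Btw (a₂ • o) (s (α + (i + κ))) ((a₂ * x) • o) := by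
        unfold Btw
        rw [← p3, ← p4, hs _ _ (by omega) (by omega), hs _ _ (by omega) (by omega),
          hs _ _ (by omega) (by omega)]
        omega
      have h1' := h1.smul a₁⁻¹
      have h2' := h2.smul a₂⁻¹
      rw [inv_smul_smul, mul_smul, inv_smul_smul] at h1' h2'
      refine T.point_unique h1' h2' ?_
      rw [T.dist_smul_right, inv_inv, T.dist_smul_right, inv_inv, ← p1, ← p3,
        hs _ _ (by omega) (by omega), hs _ _ (by omega) (by omega)]
      omega)
  refine ⟨ℓ, hℓ, ?_, ?_⟩
  · have := hℓs 0 (by omega)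
    rw [Nat.cast_zero, add_zero] at this
    rw [this, p1, inv_smul_smul]
  · have := hℓs L (by omega)
    rw [this, p2, mul_smul, inv_smul_smul]

/-- All overlaps of a given element have the same axis. -/
theorem Aligned.axis_of_overlap {κ κ' : ℕ} {h h' : G} {ℓ : ℤ → V} (ha : T.Axis h κ ℓ)
    (h2κ : 2 * κ < T.dist o (x • o)) (h0 : ℓ 0 = o) (hL : ℓ (T.dist o (x • o)) = x • o)
    (hov : T.Overlap o P Q x κ' h') : T.Axis h' κ' ℓ := by
  obtain ⟨ℓ', ha', h0', hL'⟩ := hal.exists_axis hov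
  obtain ⟨-, -, -, -, -, -, -, -, -, -, -, h2κ', -⟩ := hov
  have heq : ∀ i : ℕ, i ≤ T.dist o (x • o) → ℓ' i = ℓ i := by
    intro i hi
    have b1 : T.Btw (ℓ 0) (ℓ i) (ℓ (T.dist o (x • o))) := ha.btw (by omega)
    have b2 : T.Btw (ℓ' 0) (ℓ' i) (ℓ' (T.dist o (x • o))) := ha'.btw (by omega)
    rw [h0', hL'] at b2
    rw [h0, hL] at b1
    refine T.point_unique b2 b1 ?_
    nth_rw 1 [← h0']
    nth_rw 1 [← h0]
    rw [ha.dist, ha'.dist]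
  -- Both offsets are below half the length of `x`, so their sum is below the length, as Fine–Wilf
  -- requires.
  have hpow := T.pow_eq_pow_of_translates (s := fun i => ℓ i) (D := T.dist o (x • o)) (k := h)
    (k' := h') (fun i j hij hj => by rw [ha.dist]; omega) ha.pos ha'.pos (by omega)
    (fun i hi => by rw [ha.smul]; push_cast; rfl)
    (fun i hi => by
      rw [← heq i (by omega), ← heq _ hi, ha'.smul]; push_cast; rfl)
  rw [ha.eq_of_pow_eq ha' hpow (h0.trans h0'.symm)]
  exact ha'

end

/-- Inversion exchanges the roles of `P` and `Q`, so that results about the end of `x` also apply to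
its beginning. -/
theorem Overlap.inv [DecidableEq G] {o : V} {P Q : Finset G} {x h : G} {κ : ℕ}
    (hal : T.Aligned o P Q x) (ho : T.Overlap o P Q x κ h) :
    T.Overlap o Q⁻¹ P⁻¹ x⁻¹ κ (x⁻¹ * h⁻¹ * x) := by
  obtain ⟨a₁, ha₁, a₂, ha₂, b₁, hb₁, b₂, hb₂, he, hd, hκ, h2κ, rfl⟩ := ho
  refine ⟨b₂⁻¹, Finset.inv_mem_inv hb₂, b₁⁻¹, Finset.inv_mem_inv hb₁, a₂⁻¹,
    Finset.inv_mem_inv ha₂, a₁⁻¹, Finset.inv_mem_inv ha₁, ?_, ?_, hκ, ?_, ?_⟩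
  · rw [← mul_inv_rev, ← mul_inv_rev, ← mul_inv_rev, ← mul_inv_rev, ← mul_assoc, ← mul_assoc, he]
  · have h1 := hal.dist_mul_mul ha₁ hb₁
    have h2 := hal.dist_mul_mul ha₂ hb₂
    rw [he] at h1
    rw [dist_inv, dist_inv]
    omega
  · rwa [dist_inv]
  · rw [inv_inv, eq_mul_inv_iff_mul_eq]
    calc x⁻¹ * (a₁⁻¹ * a₂)⁻¹ * x * b₁ = x⁻¹ * a₂⁻¹ * (a₁ * x * b₁) := by group
      _ = b₂ := by rw [he]; group

theorem Aligned.inv [DecidableEq G] {o : V} {P Q : Finset G} {x : G}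
    (hal : T.Aligned o P Q x) : T.Aligned o Q⁻¹ P⁻¹ x⁻¹ := by
  refine ⟨fun h => hal.ne ?_, fun a ha => ?_, fun b hb => ?_⟩
  · rwa [eq_inv_smul_iff, eq_comm] at h
  · exact (hal.right _ (Finset.mem_inv'.mp ha)).symm
  · rw [inv_inv]
    simpa using (hal.left _ (Finset.mem_inv'.mp hb)).symm

end ArborealAction

/-! ### Rays along which a set is spread -/

namespace ArborealAction

variable {G V : Type*} [Group G] [MulAction G V] (T : ArborealAction G V)

/-- A geodesic ray from `o`. -/
structure IsRay (o : V) (ρ : ℕ → V) : Prop where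
  zero : ρ 0 = o
  dist : ∀ i j, T.dist (ρ i) (ρ j) = (i - j : ℤ).natAbs

open Classical in
/-- How far the geodesic from `o` to `v` follows the ray `ρ`. -/
noncomputable def reach (o : V) (ρ : ℕ → V) (v : V) : ℕ :=
  Nat.findGreatest (fun i => T.Btw o (ρ i) v) (T.dist o v)

variable {T}

theorem IsRay.dist_zero {o : V} {ρ : ℕ → V} (hρ : T.IsRay o ρ) (i : ℕ) : T.dist o (ρ i) = i := by
  have := hρ.dist 0 i
  rw [hρ.zero] at this
  omega

theorem IsRay.le_reach_iff {o : V} {ρ : ℕ → V} (hρ : T.IsRay o ρ) {i : ℕ} {v : V} :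
    i ≤ T.reach o ρ v ↔ T.Btw o (ρ i) v := by
  classical
  constructor
  · intro hi
    have h0 : T.Btw o (ρ 0) v := by
      unfold Btw; rw [hρ.zero, T.dist_self, zero_add]
    have h1 : T.Btw o (ρ (T.reach o ρ v)) v :=
      Nat.findGreatest_spec (P := fun i => T.Btw o (ρ i) v) (Nat.zero_le _) h0
    have h2 := T.dist_triangle (ρ i) (ρ (T.reach o ρ v)) v
    have h3 := T.dist_triangle o (ρ i) v
    rw [hρ.dist] at h2
    unfold Btw at *
    rw [hρ.dist_zero] at *
    omega
  · intro hb
    refine Nat.le_findGreatest ?_ hb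
    unfold Btw at hb
    rw [hρ.dist_zero] at hb
    omega

theorem IsRay.eq_of_le {o : V} {ρ ρ' : ℕ → V} (hρ : T.IsRay o ρ) (hρ' : T.IsRay o ρ') {i j : ℕ}
    (hij : i ≤ j) (hj : ρ j = ρ' j) : ρ i = ρ' i := by
  have b1 : T.Btw o (ρ i) (ρ j) := by
    unfold Btw; rw [hρ.dist_zero, hρ.dist_zero, hρ.dist]; omega
  have b2 : T.Btw o (ρ' i) (ρ' j) := by
    unfold Btw; rw [hρ'.dist_zero, hρ'.dist_zero, hρ'.dist]; omega
  rw [← hj] at b2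
  exact T.point_unique b1 b2 (by rw [hρ.dist_zero, hρ'.dist_zero])

/-- The elements of `Q` are spread thinly along the ray `ρ`: fewer than a quarter of them
leave the ray within any window of length `κ`. -/
def Spread (T : ArborealAction G V) (o : V) (Q : Finset G) (ρ : ℕ → V) (κ : ℕ) : Prop :=
  ∀ c, 4 * (Q.filter fun b => c ≤ T.reach o ρ (b • o) ∧ T.reach o ρ (b • o) < c + κ).card < Q.card

/-- If the rays part at `m ≤ κ + κ'`, every `b` either leaves `ρ` within the first three windows of
length `κ`, or follows `ρ` past `m` and so leaves `ρ'` exactly at `m`. These four sets cover `Q`,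
yet each holds less than a quarter of it. -/
theorem IsRay.eq_of_spread {o : V} {ρ ρ' : ℕ → V} (hρ : T.IsRay o ρ) (hρ' : T.IsRay o ρ')
    {Q : Finset G} {κ κ' : ℕ} (hle : κ' ≤ κ) (hκ' : 0 < κ') (hs : T.Spread o Q ρ κ)
    (hs' : T.Spread o Q ρ' κ') {i : ℕ} (hi : i ≤ κ + κ' + 1) : ρ i = ρ' i := by
  classical
  suffices h : ρ (κ + κ' + 1) = ρ' (κ + κ' + 1) from hρ.eq_of_le hρ' hi h
  by_contra hne
  set m := Nat.findGreatest (fun i => ρ i = ρ' i) (κ + κ' + 1) with hm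
  have hmeq : ρ m = ρ' m := Nat.findGreatest_spec (P := fun i => ρ i = ρ' i) (Nat.zero_le _)
    (hρ.zero.trans hρ'.zero.symm)
  have hmle : m ≤ κ + κ' + 1 := Nat.findGreatest_le _
  have hmlt : m < κ + κ' + 1 := lt_of_le_of_ne hmle fun h => hne (h ▸ hmeq)
  have hmne : ρ (m + 1) ≠ ρ' (m + 1) :=
    Nat.findGreatest_is_greatest (P := fun i => ρ i = ρ' i) (Nat.lt_succ_self m) hmlt
  have hsub : Q ⊆
      (Q.filter fun b => 0 ≤ T.reach o ρ (b • o) ∧ T.reach o ρ (b • o) < 0 + κ) ∪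
      (Q.filter fun b => κ ≤ T.reach o ρ (b • o) ∧ T.reach o ρ (b • o) < κ + κ) ∪
      (Q.filter fun b => 2 * κ ≤ T.reach o ρ (b • o) ∧ T.reach o ρ (b • o) < 2 * κ + κ) ∪
      (Q.filter fun b => m ≤ T.reach o ρ' (b • o) ∧ T.reach o ρ' (b • o) < m + κ') := by
    intro b hb
    simp only [Finset.mem_union, Finset.mem_filter, hb, true_and]
    by_cases hlt : T.reach o ρ (b • o) ≤ 2 * κ
    · omega
    · right
      have h1 := hρ.le_reach_iff (i := m + 1) (v := b • o) |>.mp (by omega)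
      have h2 := hρ.le_reach_iff (i := m) (v := b • o) |>.mp (by omega)
      rw [hmeq] at h2
      refine ⟨hρ'.le_reach_iff.mpr h2, ?_⟩
      by_contra! hge
      have h3 := hρ'.le_reach_iff (i := m + 1) (v := b • o) |>.mp (by omega)
      exact hmne (T.point_unique h1 h3 (by rw [hρ.dist_zero, hρ'.dist_zero]))
  have hcard := Finset.card_le_card hsub
  have c1 := hs 0
  have c2 := hs κ
  have c3 := hs (2 * κ)
  have c4 := hs' m
  have u1 := Finset.card_union_le
    ((Q.filter fun b => 0 ≤ T.reach o ρ (b • o) ∧ T.reach o ρ (b • o) < 0 + κ) ∪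
      (Q.filter fun b => κ ≤ T.reach o ρ (b • o) ∧ T.reach o ρ (b • o) < κ + κ) ∪
      (Q.filter fun b => 2 * κ ≤ T.reach o ρ (b • o) ∧ T.reach o ρ (b • o) < 2 * κ + κ))
    (Q.filter fun b => m ≤ T.reach o ρ' (b • o) ∧ T.reach o ρ' (b • o) < m + κ')
  have u2 := Finset.card_union_le
    ((Q.filter fun b => 0 ≤ T.reach o ρ (b • o) ∧ T.reach o ρ (b • o) < 0 + κ) ∪
      (Q.filter fun b => κ ≤ T.reach o ρ (b • o) ∧ T.reach o ρ (b • o) < κ + κ))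
    (Q.filter fun b => 2 * κ ≤ T.reach o ρ (b • o) ∧ T.reach o ρ (b • o) < 2 * κ + κ)
  have u3 := Finset.card_union_le
    (Q.filter fun b => 0 ≤ T.reach o ρ (b • o) ∧ T.reach o ρ (b • o) < 0 + κ)
    (Q.filter fun b => κ ≤ T.reach o ρ (b • o) ∧ T.reach o ρ (b • o) < κ + κ)
  omega

/-- Elements translating along rays on which `Q` is spread have a common power. -/
theorem IsRay.pow_eq_pow {o : V} {ρ ρ' : ℕ → V} (hρ : T.IsRay o ρ) (hρ' : T.IsRay o ρ')
    {Q : Finset G} {κ κ' : ℕ} {k k' : G} (hκ : 0 < κ) (hκ' : 0 < κ') (hs : T.Spread o Q ρ κ)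
    (hs' : T.Spread o Q ρ' κ') (hk : ∀ i, k • ρ i = ρ (i + κ))
    (hk' : ∀ i, k' • ρ' i = ρ' (i + κ')) : k ^ κ' = k' ^ κ := by
  have heq : ∀ i ≤ κ + κ' + 1, ρ i = ρ' i := by
    intro i hi
    rcases le_total κ' κ with h | h
    · exact hρ.eq_of_spread hρ' h hκ' hs hs' hi
    · exact (hρ'.eq_of_spread hρ h hκ hs' hs (by omega)).symm
  refine T.pow_eq_pow_of_translates (s := ρ) (D := κ + κ' + 1)
    (fun i j hij _ => by rw [hρ.dist]; omega) hκ hκ' (by omega) (fun i _ => hk i) (fun i hi => ?_)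
  rw [heq i (by omega), hk', heq _ hi]

/-- An overlap with the least possible offset. -/
structure LeastOverlap (T : ArborealAction G V) (o : V) (P Q : Finset G) (x : G) (κ : ℕ) (h : G) :
    Prop where
  overlap : T.Overlap o P Q x κ h
  le : ∀ κ' h', T.Overlap o P Q x κ' h' → κ ≤ κ'

theorem LeastOverlap.inv [DecidableEq G] {o : V} {P Q : Finset G} {x h : G} {κ : ℕ}
    (hal : T.Aligned o P Q x) (hl : T.LeastOverlap o P Q x κ h) :
    T.LeastOverlap o Q⁻¹ P⁻¹ x⁻¹ κ (x⁻¹ * h⁻¹ * x) := by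
  refine ⟨hl.overlap.inv hal, fun κ' h' hov => ?_⟩
  have := hov.inv hal.inv
  rw [inv_inv, inv_inv, inv_inv] at this
  exact hl.le _ _ this

/-- The ray is the part of the axis beyond `x • o`, pulled back by `x`. If a quarter of `Q` left it
within one window of length `κ`, those elements would overlap with some offset `κ' ≥ κ` along the
same axis. Then `b₁` is the translate of `b₂` by `κ'` and leaves the ray at least `κ` later, outside
the window. -/
theorem LeastOverlap.exists_ray {o : V} {P Q : Finset G} {x h : G} {κ : ℕ}
    (hl : T.LeastOverlap o P Q x κ h) (hal : T.Aligned o P Q x)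
    (hQ : ∀ Q' ⊆ Q, Q.card ≤ 4 * Q'.card → ∃ κ' h', T.Overlap o P Q' x κ' h') :
    ∃ ρ : ℕ → V, T.IsRay o ρ ∧ T.Spread o Q ρ κ ∧ ∀ i, (x⁻¹ * h * x) • ρ i = ρ (i + κ) := by
  obtain ⟨ℓ, ha, h0, hL⟩ := hal.exists_axis hl.overlap
  set L := T.dist o (x • o) with hLd
  have h2κ : 2 * κ < L := by
    obtain ⟨-, -, -, -, -, -, -, -, -, -, -, h, -⟩ := hl.overlap
    exact h
  set ρ : ℕ → V := fun i => x⁻¹ • ℓ (L + i) with hρd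
  have hρ : T.IsRay o ρ := by
    refine ⟨?_, fun i j => ?_⟩
    · simp only [hρd, Nat.cast_zero, add_zero, hL, inv_smul_smul]
    · simp only [hρd]
      rw [T.dist_smul, ha.dist]; congr 1; ring
  have hshift : ∀ κ' h', T.Axis h' κ' ℓ → ∀ i, (x⁻¹ * h' * x) • ρ i = ρ (i + κ') := by
    intro κ' h' ha' i
    simp only [hρd]
    rw [mul_smul, smul_inv_smul, mul_smul, ha'.smul]
    push_cast
    rw [add_assoc]
  refine ⟨ρ, hρ, fun c => ?_, hshift κ h ha⟩
  by_contra! hc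
  obtain ⟨κ', h', hov⟩ := hQ _ (Finset.filter_subset _ _) hc
  have hov' := hov.mono (subset_refl P) (Finset.filter_subset _ _)
  have hκκ' := hl.le _ _ hov'
  have ha' := hal.axis_of_overlap ha h2κ h0 hL hov'
  have hsh := hshift κ' h' ha'
  obtain ⟨a₁, ha₁, a₂, ha₂, b₁, hb₁, b₂, hb₂, he, hd, hκ, -, rfl⟩ := hov
  rw [Finset.mem_filter] at hb₁ hb₂
  have hb : b₁ = (x⁻¹ * (a₁⁻¹ * a₂) * x) * b₂ := by
    have : x⁻¹ * (a₁⁻¹ * a₂) * x * b₂ = x⁻¹ * a₁⁻¹ * (a₂ * x * b₂) := by group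
    rw [this, ← he]; group
  have hlen : T.dist o (b₁ • o) = T.dist o (b₂ • o) + κ' := by
    have h1 := hal.dist_mul_mul ha₁ hb₁.1
    have h2 := hal.dist_mul_mul ha₂ hb₂.1
    rw [he] at h1
    omega
  have hb2r := hρ.le_reach_iff.mp (le_refl (T.reach o ρ (b₂ • o)))
  have : T.reach o ρ (b₂ • o) + κ' ≤ T.reach o ρ (b₁ • o) := by
    rw [hρ.le_reach_iff]
    unfold Btw at *
    rw [hρ.dist_zero] at *
    have : T.dist (ρ (T.reach o ρ (b₂ • o) + κ')) (b₁ • o) =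
        T.dist (ρ (T.reach o ρ (b₂ • o))) (b₂ • o) := by
      rw [hb, mul_smul, ← hsh, T.dist_smul]
    omega
  omega

/-- If overlaps persist in all large subsets of `P` and of `Q`, both for `x` and for `y`, then
`y * x⁻¹` commutes with a power of the element that yields the least overlap of `x`. -/
theorem LeastOverlap.commute [DecidableEq G] {o : V} {P Q : Finset G} {x y h h' : G} {κ κ' : ℕ}
    (hx : T.Aligned o P Q x) (hy : T.Aligned o P Q y)
    (hlx : T.LeastOverlap o P Q x κ h) (hly : T.LeastOverlap o P Q y κ' h')
    (hov : ∀ P' ⊆ P, ∀ Q' ⊆ Q, P.card * Q.card ≤ 4 * (P'.card * Q'.card) →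
      (∃ κ h, T.Overlap o P' Q' x κ h) ∧ ∃ κ h, T.Overlap o P' Q' y κ h) :
    0 < κ' ∧ Commute (y * x⁻¹) (h ^ κ') := by
  have hκ : 0 < κ := by
    obtain ⟨-, -, -, -, -, -, -, -, -, -, h, -⟩ := hlx.overlap; exact h
  have hκ' : 0 < κ' := by
    obtain ⟨-, -, -, -, -, -, -, -, -, -, h, -⟩ := hly.overlap; exact h
  refine ⟨hκ', ?_⟩
  have hQ : ∀ Q' ⊆ Q, Q.card ≤ 4 * Q'.card →
      (∃ κ h, T.Overlap o P Q' x κ h) ∧ ∃ κ h, T.Overlap o P Q' y κ h := fun Q' hQ' hc =>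
    hov P (subset_refl _) Q' hQ' (by
      rw [mul_left_comm]; exact Nat.mul_le_mul_left _ hc)
  have hP : ∀ P' ⊆ P⁻¹, (P⁻¹).card ≤ 4 * P'.card →
      (∃ κ h, T.Overlap o Q⁻¹ P' x⁻¹ κ h) ∧ ∃ κ h, T.Overlap o Q⁻¹ P' y⁻¹ κ h := by
    intro P' hP' hc
    have hP'' : P'⁻¹ ⊆ P := fun g hg => by
      simpa using hP' (Finset.mem_inv'.mp hg)
    obtain ⟨⟨κ₁, h₁, ho₁⟩, κ₂, h₂, ho₂⟩ := hov P'⁻¹ hP'' Q (subset_refl _) (by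
      rw [Finset.card_inv] at hc ⊢
      rw [← mul_assoc]; exact Nat.mul_le_mul_right _ hc)
    have i₁ := ho₁.inv (hx.mono hP'' (subset_refl _))
    have i₂ := ho₂.inv (hy.mono hP'' (subset_refl _))
    rw [inv_inv] at i₁ i₂
    exact ⟨⟨_, _, i₁⟩, _, _, i₂⟩
  obtain ⟨ρ, r1, r2, r3⟩ := hlx.exists_ray hx fun Q' h1 h2 => (hQ Q' h1 h2).1
  obtain ⟨ρ', r1', r2', r3'⟩ := hly.exists_ray hy fun Q' h1 h2 => (hQ Q' h1 h2).2
  obtain ⟨σ, s1, s2, s3⟩ := (hlx.inv hx).exists_ray hx.inv fun Q' h1 h2 => (hP Q' h1 h2).1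
  obtain ⟨σ', s1', s2', s3'⟩ := (hly.inv hy).exists_ray hy.inv fun Q' h1 h2 => (hP Q' h1 h2).2
  -- The forward rays compare `x⁻¹ * h * x` with `y⁻¹ * h' * y`, the backward rays compare `h` with
  -- `h'`. Both comparisons carry the same exponents, so together they give the commutation.
  have e1 := r1.pow_eq_pow r1' hκ hκ' r2 r2' r3 r3'
  have e2 := s1.pow_eq_pow s1' hκ hκ' s2 s2' s3 s3'
  have c : ∀ (z g : G), z⁻¹⁻¹ * (z⁻¹ * g⁻¹ * z) * z⁻¹ = g⁻¹ := fun z g => by group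
  rw [c, c, inv_pow, inv_pow, inv_inj] at e2
  have c' : ∀ (z g : G) (n : ℕ), (z⁻¹ * g * z) ^ n = z⁻¹ * g ^ n * z := fun z g n => by
    have := conj_pow (i := n) (a := z⁻¹) (b := g)
    rwa [inv_inv] at this
  rw [c', c', ← e2] at e1
  unfold Commute SemiconjBy
  calc y * x⁻¹ * h ^ κ' = y * (x⁻¹ * h ^ κ' * x) * x⁻¹ := by group
    _ = h ^ κ' * (y * x⁻¹) := by rw [e1]; group

end ArborealAction

/-! ### The stabilizer of an axis -/

namespace ArborealAction

variable {G V : Type*} [Group G] [MulAction G V] {T : ArborealAction G V}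

section Axis

variable {h : G} {κ : ℕ} {ℓ : ℤ → V} (a : T.Axis h κ ℓ)

include a

/-- The relation `hc` keeps points of `g • ℓ` arbitrarily far out in both directions within the
fixed distance `D` of `ℓ`. Since `g • ℓ i` lies between two such points, `Btw.shift` replaces them
by points of `ℓ`. -/
theorem Axis.smul_mem_range {g : G} {m m' : ℤ} (hm : m ≠ 0)
    (hc : g * h ^ m = h ^ m' * g) (i : ℤ) : ∃ j, g • ℓ i = ℓ j := by
  set D := T.dist (ℓ 0) (g • ℓ 0) with hD
  set n : ℤ := D + i.natAbs + 1 with hn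
  have hκ : (1 : ℤ) ≤ κ := by exact_mod_cast a.pos
  have habs : n ≤ |m * n * κ| := by
    have h1 : 1 ≤ |m| := Int.one_le_abs hm
    have hn0 : 0 ≤ n := by omega
    rw [abs_mul, abs_mul, abs_of_nonneg hn0, abs_of_nonneg (by omega : (0 : ℤ) ≤ κ)]
    nlinarith [mul_nonneg (sub_nonneg.mpr h1) hn0,
      mul_nonneg (mul_nonneg (abs_nonneg m) hn0) (sub_nonneg.mpr hκ)]
  have hcn : ∀ n : ℤ, g * h ^ (m * n) = h ^ (m' * n) * g := by
    intro n
    have : h ^ m' = g * h ^ m * g⁻¹ := by rw [hc]; group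
    rw [zpow_mul, zpow_mul, this, conj_zpow]; group
  have hend : ∀ n : ℤ, T.dist (g • ℓ (m * n * κ)) (ℓ (m' * n * κ)) = D := by
    intro n
    have e1 := a.zpow (m * n) 0
    have e2 := a.zpow (m' * n) 0
    rw [zero_add] at e1 e2
    rw [← e1, ← mul_smul, hcn, ← e2, mul_smul, T.dist_smul, T.dist_comm]
  have hmid : T.Btw (g • ℓ (m * n * κ)) (g • ℓ i) (g • ℓ (m * (-n) * κ)) := by
    refine (a.btw ?_).smul g
    have : m * (-n) * κ = -(m * n * κ) := by ring
    rw [this]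
    rcases abs_cases (m * n * κ) with h | h <;> omega
  have hd : ∀ k : ℤ, n ≤ |k| → D < T.dist (g • ℓ k) (g • ℓ i) := by
    intro k hk
    rw [T.dist_smul, a.dist]
    rcases abs_cases k with h | h <;> omega
  have s1 := hmid.shift (p' := ℓ (m' * n * κ)) (by rw [hend]; exact hd _ habs)
  have s2 := s1.symm.shift (p' := ℓ (m' * (-n) * κ)) (by
    rw [hend]
    refine hd _ ?_
    rwa [mul_neg, neg_mul, abs_neg])
  exact a.eq_of_btw s2

theorem Axis.mem_stabilizer {g : G} {m m' : ℤ} (hm : m ≠ 0) (hm' : m' ≠ 0)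
    (hc : g * h ^ m = h ^ m' * g) : g ∈ MulAction.stabilizer G (Set.range ℓ) := by
  rw [MulAction.mem_stabilizer_iff]
  have hc' : g⁻¹ * h ^ m' = h ^ m * g⁻¹ := by
    rw [inv_mul_eq_iff_eq_mul, ← mul_assoc, hc, mul_inv_cancel_right]
  ext v
  rw [Set.mem_smul_set_iff_inv_smul_mem]
  constructor
  · rintro ⟨i, hi⟩
    obtain ⟨j, hj⟩ := a.smul_mem_range hm hc i
    exact ⟨j, by rw [← hj, hi, smul_inv_smul]⟩
  · rintro ⟨i, rfl⟩
    obtain ⟨j, hj⟩ := a.smul_mem_range hm' hc' i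
    exact ⟨j, hj.symm⟩

theorem Axis.exists_affine {g : G} (hg : g ∈ MulAction.stabilizer G (Set.range ℓ)) :
    ∃ ε s : ℤ, (ε = 1 ∨ ε = -1) ∧ ∀ i, g • ℓ i = ℓ (ε * i + s) := by
  rw [MulAction.mem_stabilizer_iff] at hg
  have hf : ∀ i, ∃ j, g • ℓ i = ℓ j := by
    intro i
    have : g • ℓ i ∈ g • Set.range ℓ := Set.smul_mem_smul_set ⟨i, rfl⟩
    rw [hg] at this
    obtain ⟨j, hj⟩ := this
    exact ⟨j, hj.symm⟩
  choose f hf using hf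
  have hd : ∀ i j, (f i - f j).natAbs = (i - j).natAbs := by
    intro i j
    rw [← a.dist, ← hf, ← hf, T.dist_smul, a.dist]
  have h10 := hd 1 0
  refine ⟨f 1 - f 0, f 0, by omega, fun i => ?_⟩
  rw [hf]
  congr 1
  have h1 := hd i 0
  have h2 := hd i 1
  rcases (by omega : f 1 - f 0 = 1 ∨ f 1 - f 0 = -1) with e | e <;> rw [e] <;> omega

/-- An element acts on the axis as `i ↦ ε * i + s` and is determined by this action. Powers of `h`
change `s` by multiples of `κ`, so there are at most `2 * κ` cosets. -/
theorem Axis.isVirtuallyCyclic_stabilizer :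
    Group.IsVirtuallyCyclic (MulAction.stabilizer G (Set.range ℓ)) := by
  set E := MulAction.stabilizer G (Set.range ℓ)
  have hh : h ∈ E := a.mem_stabilizer (m := 1) (m' := 1) one_ne_zero one_ne_zero
    ((Commute.refl h).zpow_right 1).eq
  let k : E := ⟨h, hh⟩
  refine ⟨Subgroup.zpowers k, inferInstance, ?_⟩
  choose ε s hε hs using fun g : E => a.exists_affine (g⁻¹).2
  have hκ : (0 : ℤ) < κ := by exact_mod_cast a.pos
  have key : ∀ g g' : E, ε g = ε g' → s g % κ = s g' % κ → g⁻¹ * g' ∈ Subgroup.zpowers k := by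
    intro g g' h1 h2
    obtain ⟨n, hn⟩ : (κ : ℤ) ∣ s g' - s g := Int.ModEq.dvd h2
    have hfix : ∀ i, ((g'⁻¹ : E) : G) • ℓ i = (h ^ n * ((g⁻¹ : E) : G)) • ℓ i := by
      intro i
      rw [mul_smul, hs, hs, a.zpow, h1]
      congr 1
      have := mul_comm n (κ : ℤ)
      omega
    have h01 : ℓ 0 ≠ ℓ 1 := fun h => by simpa using a.injective h
    have e := T.eq_of_smul_eq h01 (hfix 0) (hfix 1)
    have e' : g'⁻¹ = k ^ n * g⁻¹ := by
      apply Subtype.ext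
      rw [e]; simp [k]
    refine ⟨-n, ?_⟩
    have : g' = g * (k ^ n)⁻¹ := by
      rw [← inv_inv g', e', mul_inv_rev, inv_inv]
    dsimp only
    rw [this, zpow_neg, inv_mul_cancel_left]
  have hfin : Finite (E ⧸ Subgroup.zpowers k) := by
    refine Finite.of_injective (β := ({1, -1} : Finset ℤ) × (Finset.Ico (0 : ℤ) κ))
      (fun q => (⟨ε q.out, by simpa using hε q.out⟩, ⟨s q.out % κ, by
        rw [Finset.mem_Ico]
        exact ⟨Int.emod_nonneg _ hκ.ne', Int.emod_lt_of_pos _ hκ⟩⟩)) ?_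
    intro q q' hq
    simp only [Prod.mk.injEq, Subtype.mk.injEq] at hq
    rw [← q.out_eq, ← q'.out_eq]
    exact QuotientGroup.eq.mpr (key _ _ hq.1 hq.2)
  exact Subgroup.finiteIndex_of_finite_quotient

/-- A reflection of the axis would conjugate the translation `h ^ m` to its inverse. -/
theorem Axis.exists_translation {g : G} {m : ℕ} (hm : 0 < m) (hc : Commute g (h ^ m)) :
    ∃ s : ℤ, ∀ i, g • ℓ i = ℓ (i + s) := by
  have hm0 : (m : ℤ) ≠ 0 := by omega
  have hc' : g * h ^ (m : ℤ) = h ^ (m : ℤ) * g := by rw [zpow_natCast]; exact hc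
  obtain ⟨ε, s, hε, hs⟩ := a.exists_affine (a.mem_stabilizer hm0 hm0 hc')
  refine ⟨s, ?_⟩
  rcases hε with rfl | rfl
  · simpa using hs
  · exfalso
    have e : (g * h ^ (m : ℤ)) • ℓ 0 = (h ^ (m : ℤ) * g) • ℓ 0 := by rw [hc']
    rw [mul_smul, mul_smul, a.zpow, hs, hs, a.zpow] at e
    have := a.injective e
    have h2 : 0 < (m : ℤ) * κ := by
      have := Nat.mul_pos hm a.pos
      exact_mod_cast this
    omega

theorem Axis.pow_eq_zpow {g : G} {s : ℤ} (hs : ∀ i, g • ℓ i = ℓ (i + s)) : g ^ κ = h ^ s := by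
  have hn : ∀ (n : ℕ) (i : ℤ), g ^ n • ℓ i = ℓ (i + n * s) := by
    intro n
    induction n with
    | zero => simp
    | succ n ih =>
      intro i
      rw [pow_succ, mul_smul, hs, ih]; congr 1; push_cast; ring
  have h01 : ℓ 0 ≠ ℓ 1 := fun h => by simpa using a.injective h
  refine T.eq_of_smul_eq h01 ?_ ?_ <;> rw [hn, a.zpow] <;> congr 1 <;> ring

theorem Axis.eq_one_of_translation_zero {g : G} (hs : ∀ i, g • ℓ i = ℓ (i + 0)) : g = 1 := by
  have h01 : ℓ 0 ≠ ℓ 1 := fun h => by simpa using a.injective h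
  exact T.eq_one_of_fix h01 (by simpa using hs 0) (by simpa using hs 1)

/-- Double cosets of the centralizer of an axis by an element that moves the axis have unique
representations. -/
theorem Axis.mul_mul_injOn {X : Set G} {x₀ z : G}
    (hX : ∀ y ∈ X, ∃ m : ℕ, 0 < m ∧ Commute (y * x₀⁻¹) (h ^ m))
    (hz : x₀ * z ∉ MulAction.stabilizer G (Set.range ℓ)) :
    Set.InjOn (fun p : G × G => p.1 * z * p.2) (X ×ˢ X) := by
  have hT : ∀ y ∈ X, ∃ s : ℤ, ∀ i, (y * x₀⁻¹) • ℓ i = ℓ (i + s) := fun y hy => by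
    obtain ⟨m, hm, hc⟩ := hX y hy
    exact a.exists_translation hm hc
  have hT' : ∀ y ∈ X, ∃ s : ℤ, ∀ i, (y * x₀⁻¹)⁻¹ • ℓ i = ℓ (i + s) := fun y hy => by
    obtain ⟨s, hs⟩ := hT y hy
    exact ⟨-s, fun i => by rw [inv_smul_eq_iff, hs]; congr 1; ring⟩
  rintro ⟨u, v⟩ ⟨hu, hv⟩ ⟨u', v'⟩ ⟨hu', hv'⟩ he
  dsimp only at hu hv hu' hv' he
  set c₁ := (u' * x₀⁻¹)⁻¹ * (u * x₀⁻¹) with hc₁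
  set c₂ := (v' * x₀⁻¹) * (v * x₀⁻¹)⁻¹ with hc₂
  have hg : c₁ * (x₀ * z) = (x₀ * z) * c₂ := by
    calc c₁ * (x₀ * z) = x₀ * u'⁻¹ * (u * z * v) * v⁻¹ := by rw [hc₁]; group
      _ = (x₀ * z) * c₂ := by rw [he, hc₂]; group
  obtain ⟨s₁, hs₁⟩ : ∃ s : ℤ, ∀ i, c₁ • ℓ i = ℓ (i + s) := by
    obtain ⟨s, hs⟩ := hT u hu
    obtain ⟨s', hs'⟩ := hT' u' hu'
    exact ⟨s + s', fun i => by rw [hc₁, mul_smul, hs, hs', add_assoc]⟩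
  obtain ⟨s₂, hs₂⟩ : ∃ s : ℤ, ∀ i, c₂ • ℓ i = ℓ (i + s) := by
    obtain ⟨s, hs⟩ := hT' v hv
    obtain ⟨s', hs'⟩ := hT v' hv'
    exact ⟨s + s', fun i => by rw [hc₂, mul_smul, hs, hs', add_assoc]⟩
  -- `x₀ * z` conjugates `c₂` to `c₁`, and the `κ`-th powers of these are powers of `h`. Were they
  -- nontrivial, `x₀ * z` would preserve the axis.
  have hconj : (x₀ * z) * h ^ s₂ = h ^ s₁ * (x₀ * z) := by
    rw [← a.pow_eq_zpow hs₁, ← a.pow_eq_zpow hs₂]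
    have : c₁ = (x₀ * z) * c₂ * (x₀ * z)⁻¹ := by rw [← hg, mul_inv_cancel_right]
    rw [this, conj_pow, inv_mul_cancel_right]
  have hone : c₁ = 1 := by
    by_contra hne
    have h1 : s₁ ≠ 0 := by
      rintro rfl
      exact hne (a.eq_one_of_translation_zero hs₁)
    have h2 : s₂ ≠ 0 := by
      rintro rfl
      have := a.eq_one_of_translation_zero hs₂
      rw [this, mul_one] at hg
      exact hne (mul_eq_right.mp hg)
    exact hz (a.mem_stabilizer h2 h1 hconj)
  have huu : u = u' := by
    have := inv_mul_eq_one.mp hone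
    exact (mul_right_cancel this).symm
  subst huu
  exact Prod.ext rfl (mul_left_cancel he)

theorem Axis.card_sq_le [DecidableEq G] {A X : Finset G} {x₀ : G} (hXA : X ⊆ A)
    (hX : ∀ y ∈ X, ∃ m : ℕ, 0 < m ∧ Commute (y * x₀⁻¹) (h ^ m))
    (hA : ¬ (A : Set G) ⊆ MulAction.stabilizer G (Set.range ℓ)) :
    X.card ^ 2 ≤ (A ^ 3).card := by
  rw [Set.not_subset] at hA
  obtain ⟨y, hy, hyE⟩ := hA
  have key : ∀ z, x₀ * z ∉ MulAction.stabilizer G (Set.range ℓ) →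
      X.card ^ 2 = ((X ×ˢ X).image fun p => p.1 * z * p.2).card := by
    intro z hz
    rw [Finset.card_image_of_injOn, Finset.card_product, sq]
    rw [Finset.coe_product]
    exact a.mul_mul_injOn hX hz
  -- If `x₀` preserves the axis, an element of `A` that moves it serves as `z`. Otherwise `z = 1`
  -- does, and already `X * X` is large.
  by_cases hx : x₀ ∈ MulAction.stabilizer G (Set.range ℓ)
  · rw [key y fun hxy => hyE ((Subgroup.mul_mem_cancel_left _ hx).mp hxy)]
    refine Finset.card_le_card ?_
    intro g hg
    simp only [Finset.mem_image, Finset.mem_product] at hg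
    obtain ⟨p, ⟨h1, h2⟩, rfl⟩ := hg
    rw [pow_succ, sq]
    exact Finset.mul_mem_mul (Finset.mul_mem_mul (hXA h1) hy) (hXA h2)
  · rw [key 1 (by rwa [mul_one])]
    have : A.Nonempty := ⟨y, hy⟩
    rw [pow_succ A 2]
    refine le_trans (Finset.card_le_card ?_) (Finset.card_le_card_mul_right this)
    intro g hg
    simp only [Finset.mem_image, Finset.mem_product] at hg
    obtain ⟨p, ⟨h1, h2⟩, rfl⟩ := hg
    rw [sq, mul_one]
    exact Finset.mul_mem_mul (hXA h1) (hXA h2)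

end Axis

end ArborealAction

/-! ### Splitting a finite set by directions -/

section Counting

variable {α β : Type*}

open Classical in
theorem Finset.exists_initial_subset (S : Finset α) (len : α → ℕ) (k : ℕ) (hk : k ≤ S.card) :
    ∃ P ⊆ S, P.card = k ∧ ∀ a ∈ P, ∀ x ∈ S \ P, len a ≤ len x := by
  induction k with
  | zero => exact ⟨∅, by simp, rfl, by simp⟩
  | succ k ih =>
    obtain ⟨P, hPS, hP, hlen⟩ := ih (by omega)
    have hne : (S \ P).Nonempty := by
      rw [← Finset.card_pos, Finset.card_sdiff_of_subset hPS]; omega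
    obtain ⟨m, hm, hmin⟩ := Finset.exists_min_image (S \ P) len hne
    have hm' := Finset.mem_sdiff.mp hm
    refine ⟨insert m P, Finset.insert_subset hm'.1 hPS, ?_, ?_⟩
    · rw [Finset.card_insert_of_notMem hm'.2, hP]
    · intro a ha x hx
      have hx' : x ∈ S \ P := by
        rw [Finset.mem_sdiff, Finset.mem_insert, not_or] at hx
        exact Finset.mem_sdiff.mpr ⟨hx.1, hx.2.2⟩
      rcases Finset.mem_insert.mp ha with rfl | ha
      · exact hmin x hx'
      · exact hlen a ha x hx'

open Classical in
-- A single class of at least a third will do. If there is none, a minimal union of classes that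
-- reaches a third overshoots by less than another third.
theorem Finset.exists_balanced_split (S : Finset α) (φ : α → β)
    (h : ∀ e, 3 * (S.filter fun a => φ a = e).card < 2 * S.card) :
    ∃ C : Finset β, S.card ≤ 3 * (S.filter fun a => φ a ∈ C).card ∧
      S.card ≤ 3 * (S.filter fun a => φ a ∉ C).card := by
  have hsum : ∀ C : Finset β, (S.filter fun a => φ a ∈ C).card +
      (S.filter fun a => φ a ∉ C).card = S.card := fun C =>
    Finset.card_filter_add_card_filter_not _
  by_cases hbig : ∃ e, S.card ≤ 3 * (S.filter fun a => φ a = e).card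
  · obtain ⟨e, he⟩ := hbig
    refine ⟨{e}, by simpa using he, ?_⟩
    have h1 := hsum {e}
    have h2 := h e
    simp only [Finset.mem_singleton] at h1 ⊢
    omega
  · push Not at hbig
    have hex : ∃ n, ∃ C : Finset β, C.card = n ∧ S.card ≤ 3 * (S.filter fun a => φ a ∈ C).card := by
      refine ⟨_, S.image φ, rfl, ?_⟩
      rw [Finset.filter_true_of_mem fun a ha => Finset.mem_image_of_mem _ ha]
      omega
    obtain ⟨C, hCn, hC⟩ := Nat.find_spec hex
    refine ⟨C, hC, ?_⟩
    rcases C.eq_empty_or_nonempty with rfl | ⟨c, hc⟩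
    · simp only [Finset.notMem_empty, not_false_eq_true, Finset.filter_true]
      omega
    · have hlt : ¬ S.card ≤ 3 * (S.filter fun a => φ a ∈ C.erase c).card := fun hle =>
        Nat.find_min hex (m := (C.erase c).card)
          (by rw [← hCn]; exact Finset.card_erase_lt_of_mem hc) ⟨_, rfl, hle⟩
      have hsub : (S.filter fun a => φ a ∈ C) ⊆
          (S.filter fun a => φ a ∈ C.erase c) ∪ S.filter fun a => φ a = c := by
        intro a ha
        simp only [Finset.mem_union, Finset.mem_filter, Finset.mem_erase] at ha ⊢
        tauto
      have h1 := (Finset.card_le_card hsub).trans (Finset.card_union_le _ _)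
      have h2 := hbig c
      have h3 := hsum C
      omega

open Classical in
-- `Y` keeps the majority side of a balanced split, and `S` keeps the other side.
theorem Finset.exists_avoiding_subsets (S Y : Finset α) (φ ψ : α → β)
    (h : ∀ e, 3 * (S.filter fun a => φ a = e).card < 2 * S.card) :
    ∃ Q ⊆ S, ∃ X ⊆ Y, S.card ≤ 3 * Q.card ∧ Y.card ≤ 2 * X.card ∧
      ∀ b ∈ Q, ∀ x ∈ X, φ b ≠ ψ x := by
  obtain ⟨C, h1, h2⟩ := S.exists_balanced_split φ h
  have hsum : (Y.filter fun a => ψ a ∈ C).card + (Y.filter fun a => ψ a ∉ C).card = Y.card :=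
    Finset.card_filter_add_card_filter_not _
  by_cases hY : Y.card ≤ 2 * (Y.filter fun a => ψ a ∈ C).card
  · refine ⟨_, Finset.filter_subset _ _, _, Finset.filter_subset _ _, h2, hY, ?_⟩
    intro b hb x hx he
    rw [Finset.mem_filter] at hb hx
    exact hb.2 (he ▸ hx.2)
  · refine ⟨_, Finset.filter_subset _ _, _, Finset.filter_subset (fun a => ψ a ∉ C) _, h1,
      by omega, ?_⟩
    intro b hb x hx he
    rw [Finset.mem_filter] at hb hx
    exact hx.2 (he ▸ hb.2)

theorem sq_le_of_le_mul {n p q c d : ℕ} (hp : n ≤ c * p) (hq : n ≤ d * q) (hcd : c * d ≤ 648) :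
    n ^ 2 ≤ 648 * (p * q) := by
  calc n ^ 2 = n * n := sq n
    _ ≤ (c * p) * (d * q) := Nat.mul_le_mul hp hq
    _ = (c * d) * (p * q) := by ring
    _ ≤ 648 * (p * q) := Nat.mul_le_mul_right _ hcd

open Classical in
/-- Here `f a` and `g a` stand for the directions of `a • o` and of `a⁻¹ • o` as seen from `o`. -/
theorem Finset.exists_directed_triple (A : Finset α) (f g : α → β) (o : β) (len : α → ℕ)
    (hN : 7776 ≤ A.card) (hfix : 88 * (A.filter fun a => f a = o).card < A.card)
    (hfg : ∀ a, g a = o ↔ f a = o)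
    (hcount : ∀ e, (A.filter fun a => f a = e).card + (A.filter fun a => g a = e).card ≤ A.card) :
    ∃ P ⊆ A, ∃ X ⊆ A, ∃ Q ⊆ A, (∀ a ∈ P, ∀ x ∈ X, g a ≠ f x) ∧ (∀ x ∈ X, ∀ b ∈ Q, g x ≠ f b) ∧
      (∀ x ∈ X, f x ≠ o) ∧ (∀ a ∈ P, ∀ x ∈ X, len a ≤ len x) ∧ A.card ≤ 88 * X.card ∧
      A.card ^ 2 ≤ 648 * (P.card * Q.card) := by
  have hfix' : (A.filter fun a => g a = o) = A.filter fun a => f a = o :=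
    Finset.filter_congr fun a _ => hfg a
  by_cases hu : ∃ e, 2 * A.card ≤ 3 * (A.filter fun a => f a = e).card
  · obtain ⟨e, he⟩ := hu
    have heo : e ≠ o := by rintro rfl; omega
    -- By `hcount` at most a third has `g a = e`, so `X₀` has at least a third of `A`. Its shorter
    -- half serves as `P` and its longer half as `X`; the bound 7 instead of 6 absorbs rounding.
    set X₀ := A.filter fun a => f a = e ∧ g a ≠ e with hX₀
    have hc := hcount e
    have hsub : (A.filter fun a => f a = e) ⊆ X₀ ∪ A.filter fun a => g a = e := by
      intro a ha
      simp only [hX₀, Finset.mem_union, Finset.mem_filter] at ha ⊢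
      tauto
    have hcard := (Finset.card_le_card hsub).trans (Finset.card_union_le _ _)
    obtain ⟨P, hP, hPc, hlen⟩ := X₀.exists_initial_subset len (X₀.card / 2) (Nat.div_le_self _ _)
    have hX₀A : X₀ ⊆ A := Finset.filter_subset _ _
    have hXc := Finset.card_sdiff_of_subset hP
    refine ⟨P, hP.trans hX₀A, X₀ \ P, Finset.sdiff_subset.trans hX₀A, _, Finset.filter_subset _ _,
      ?_, ?_, ?_, hlen, by omega, sq_le_of_le_mul (c := 7) (by omega) (d := 2)
      (q := (A.filter fun a => f a = e).card) (by omega) (by norm_num)⟩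
    · intro a ha x hx
      have h1 := (Finset.mem_filter.mp (hP ha)).2
      have h2 := (Finset.mem_filter.mp (Finset.sdiff_subset hx)).2
      rw [h2.1]; exact h1.2
    · intro x hx b hb
      have h1 := (Finset.mem_filter.mp hb).2
      have h2 := (Finset.mem_filter.mp (Finset.sdiff_subset hx)).2
      rw [h1]; exact h2.2
    · intro x hx
      have h2 := (Finset.mem_filter.mp (Finset.sdiff_subset hx)).2
      rw [h2.1]; exact heo
  by_cases hv : ∃ e, 2 * A.card ≤ 3 * (A.filter fun a => g a = e).card
  · obtain ⟨e, he⟩ := hv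
    have heo : e ≠ o := by rintro rfl; rw [hfix'] at he; omega
    set X₀ := A.filter fun a => g a = e ∧ f a ≠ e with hX₀
    have hc := hcount e
    have hsub : (A.filter fun a => g a = e) ⊆ X₀ ∪ A.filter fun a => f a = e := by
      intro a ha
      simp only [hX₀, Finset.mem_union, Finset.mem_filter] at ha ⊢
      tauto
    have hcard := (Finset.card_le_card hsub).trans (Finset.card_union_le _ _)
    have hnot : (A.filter fun a => f a = e).card + (A.filter fun a => ¬ f a = e).card = A.card :=
      Finset.card_filter_add_card_filter_not _
    obtain ⟨P, hP, hPc, hlen⟩ := X₀.exists_initial_subset len (X₀.card / 2) (Nat.div_le_self _ _)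
    have hX₀A : X₀ ⊆ A := Finset.filter_subset _ _
    have hXc := Finset.card_sdiff_of_subset hP
    refine ⟨P, hP.trans hX₀A, X₀ \ P, Finset.sdiff_subset.trans hX₀A, _, Finset.filter_subset _ _,
      ?_, ?_, ?_, hlen, by omega, sq_le_of_le_mul (c := 7) (by omega) (d := 2)
      (q := (A.filter fun a => ¬ f a = e).card) (by omega) (by norm_num)⟩
    · intro a ha x hx
      have h1 := (Finset.mem_filter.mp (hP ha)).2
      have h2 := (Finset.mem_filter.mp (Finset.sdiff_subset hx)).2
      rw [h1.1]; exact h2.2.symm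
    · intro x hx b hb
      have h1 := (Finset.mem_filter.mp hb).2
      have h2 := (Finset.mem_filter.mp (Finset.sdiff_subset hx)).2
      rw [h2.1]; exact fun h => h1 h.symm
    · intro x hx
      have h2 := (Finset.mem_filter.mp (Finset.sdiff_subset hx)).2
      exact fun h => heo (h2.1.symm.trans ((hfg x).mpr h))
  push Not at hu hv
  -- With no dominant direction, `P` is taken from the shortest sixth `S` and `X` from the rest. A
  -- sixth is small enough that removing `S`, one direction of `f` (below 2/3) and the few `a` with
  -- `f a = o` still leaves enough for `X`.
  obtain ⟨S, hS, hSc, hlen⟩ := A.exists_initial_subset len (A.card / 6) (Nat.div_le_self _ _)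
  have hTc := Finset.card_sdiff_of_subset hS
  by_cases hdom : ∃ e, 2 * S.card ≤ 3 * (S.filter fun a => g a = e).card
  · obtain ⟨e, he⟩ := hdom
    set Y := (A \ S).filter fun x => f x ≠ e ∧ f x ≠ o with hY
    have hsub : A \ S ⊆ (Y ∪ A.filter fun a => f a = e) ∪ A.filter fun a => f a = o := by
      intro a ha
      simp only [hY, Finset.mem_union, Finset.mem_filter, ha, (Finset.mem_sdiff.mp ha).1]
      tauto
    have hcard := (Finset.card_le_card hsub).trans (Finset.card_union_le _ _)
    have hcard' := Finset.card_union_le Y (A.filter fun a => f a = e)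
    obtain ⟨Q, hQ, X, hX, hQc, hXc, hav⟩ := A.exists_avoiding_subsets Y f g hu
    have hYA : Y ⊆ A \ S := Finset.filter_subset _ _
    have hue := hu e
    refine ⟨_, (Finset.filter_subset _ _).trans hS, X, (hX.trans hYA).trans Finset.sdiff_subset,
      Q, hQ, ?_, fun x hx b hb => (hav b hb x hx).symm, ?_, ?_, by omega,
      sq_le_of_le_mul (c := 10) (p := (S.filter fun a => g a = e).card) (by omega) hQc
        (by norm_num)⟩
    · intro a ha x hx
      rw [(Finset.mem_filter.mp ha).2]
      exact (Finset.mem_filter.mp (hX hx)).2.1.symm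
    · intro x hx
      exact (Finset.mem_filter.mp (hX hx)).2.2
    · intro a ha x hx
      exact hlen a (Finset.mem_filter.mp ha).1 x (hYA (hX hx))
  · push Not at hdom
    set Y := (A \ S).filter fun x => f x ≠ o with hY
    have hsub : A \ S ⊆ Y ∪ A.filter fun a => f a = o := by
      intro a ha
      simp only [hY, Finset.mem_union, Finset.mem_filter, ha, (Finset.mem_sdiff.mp ha).1]
      tauto
    have hcard := (Finset.card_le_card hsub).trans (Finset.card_union_le _ _)
    obtain ⟨P, hP, Y', hY', hPc, hYc', hav'⟩ := S.exists_avoiding_subsets Y g f hdom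
    obtain ⟨Q, hQ, X, hX, hQc, hXc, hav⟩ := A.exists_avoiding_subsets Y' f g hu
    have hYA : Y ⊆ A \ S := Finset.filter_subset _ _
    have hXA := (hX.trans hY').trans hYA
    refine ⟨P, hP.trans hS, X, hXA.trans Finset.sdiff_subset, Q, hQ,
      fun a ha x hx => hav' a ha x (hX hx), fun x hx b hb => (hav b hb x hx).symm, ?_,
      fun a ha x hx => hlen a (hP ha) x (hXA hx), by omega,
      sq_le_of_le_mul (c := 19) (by omega) hQc (by norm_num)⟩
    intro x hx
    exact (Finset.mem_filter.mp (hY' (hX hx))).2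

end Counting

/-! ### The central vertex and the tripling theorem for trees -/

namespace ArborealAction

variable {G V : Type*} [Group G] [MulAction G V] (T : ArborealAction G V)

open Classical in
/-- The neighbour of `o` towards `v`, or `o` itself if `v = o`. -/
noncomputable def dir (o v : V) : V :=
  if h : o ≠ v then (T.exists_step o v h).choose else o

theorem dir_self (o : V) : T.dir o o = o := by simp [dir]

theorem dist_dir {o v : V} (h : o ≠ v) :
    T.dist o (T.dir o v) = 1 ∧ T.dist (T.dir o v) v + 1 = T.dist o v := by
  rw [dir, dif_pos h]
  exact (T.exists_step o v h).choose_spec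

theorem dir_eq {o v e : V} (h1 : T.dist o e = 1) (h2 : T.dist e v + 1 = T.dist o v) :
    T.dir o v = e := by
  have hne : o ≠ v := by rintro rfl; rw [T.dist_self] at h2; omega
  obtain ⟨h3, h4⟩ := T.dist_dir hne
  exact T.point_unique (u := o) (v := v) (by unfold Btw; omega) (by unfold Btw; omega)
    (h3.trans h1.symm)

theorem dir_eq_self_iff {o v : V} : T.dir o v = o ↔ v = o := by
  constructor
  · intro h
    by_contra hne
    have := (T.dist_dir (Ne.symm hne)).1
    rw [h, T.dist_self] at this
    omega
  · rintro rfl; exact T.dir_self _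

/-- Even perimeters forbid `e` and `o` to be equally far from `w`, so the first step towards `v`
leads away from `w`. -/
theorem btw_of_dir_ne {o v w : V} (h : T.dir o v ≠ T.dir o w) : T.Btw v o w := by
  by_cases hv : o = v
  · subst hv; unfold Btw; rw [T.dist_self, zero_add]
  obtain ⟨h1, h2⟩ := T.dist_dir hv
  set e := T.dir o v
  have h3 : T.dist e w + 1 ≠ T.dist o w := fun h' => h (T.dir_eq h1 h').symm
  have h4 := T.dist_triangle o e w
  have h5 := T.dist_triangle e o w
  have h6 := T.even_perimeter o e w
  have h7 := T.four_point e w v o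
  have h8 := T.dist_triangle v o w
  rw [T.dist_comm e o] at h5 h7
  rw [T.dist_comm w o, T.dist_comm v o, T.dist_comm w v] at h7
  rw [Nat.even_iff] at h6
  unfold Btw
  rw [T.dist_comm v o] at h8 ⊢
  omega

open Classical in
theorem dist_displacement_le (o e : V) (he : T.dist o e = 1) (g : G) :
    T.dist e (g • e) + 2 * ((if T.dir o (g • o) = e then 1 else 0) +
      (if T.dir o (g⁻¹ • o) = e then 1 else 0)) ≤ T.dist o (g • o) + 2 := by
  have hge : T.dist (g • o) (g • e) = 1 := by rw [T.dist_smul, he]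
  have heo : e ≠ o := by rintro rfl; rw [T.dist_self] at he; omega
  have hc := T.dist_comm e o
  have t1 := T.dist_triangle e o (g • e)
  have t2 := T.dist_triangle o (g • o) (g • e)
  have t3 := T.dist_triangle e (g • o) (g • e)
  have d1 : T.dir o (g • o) = e → T.dist e (g • o) + 1 = T.dist o (g • o) := by
    intro h
    have hne : o ≠ g • o := by
      intro h'
      rw [← h', T.dir_self] at h
      exact heo h.symm
    have := (T.dist_dir hne).2
    rwa [h] at this
  have d2 : T.dir o (g⁻¹ • o) = e → T.dist o (g • e) + 1 = T.dist o (g • o) := by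
    intro h
    have hne : o ≠ g⁻¹ • o := by
      intro h'
      rw [← h', T.dir_self] at h
      exact heo h.symm
    have := (T.dist_dir hne).2
    rw [h, T.dist_smul_right, inv_inv, T.dist_smul_right, inv_inv, T.dist_comm,
      T.dist_comm (g • o)] at this
    exact this
  by_cases h1 : T.dir o (g • o) = e
  · by_cases h2 : T.dir o (g⁻¹ • o) = e
    · rw [if_pos h1, if_pos h2]
      have e1 := d1 h1
      have e2 := d2 h2
      -- Parity excludes displacement 1, in which case `g` would invert the edge from `o` to `e`.
      have ev := T.even_displacement g o
      have fp := T.four_point o (g • o) e (g • e)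
      rw [Nat.even_iff] at ev
      rw [T.dist_comm (g • o) e] at fp
      omega
    · rw [if_pos h1, if_neg h2]
      have e1 := d1 h1
      omega
  · by_cases h2 : T.dir o (g⁻¹ • o) = e
    · rw [if_neg h1, if_pos h2]
      have e2 := d2 h2
      omega
    · rw [if_neg h1, if_neg h2]
      omega

open Classical in
-- At a minimum of the total displacement, no step to a neighbour `e` can gain. By
-- `dist_displacement_le` that step costs at most 2 for each element and recovers 2 for each of the
-- two directions that points to `e`.
theorem exists_central_vertex [Nonempty V] (A : Finset G) : ∃ o : V, ∀ e, T.dist o e = 1 →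
    (A.filter fun a => T.dir o (a • o) = e).card +
      (A.filter fun a => T.dir o (a⁻¹ • o) = e).card ≤ A.card := by
  let E : V → ℕ := fun v => ∑ a ∈ A, T.dist v (a • v)
  refine ⟨Function.argmin E, fun e he => ?_⟩
  set o := Function.argmin E
  have hmin : E o ≤ E e := Function.argmin_le E e
  have hsum := Finset.sum_le_sum fun a (_ : a ∈ A) => T.dist_displacement_le o e he a
  rw [Finset.sum_add_distrib, ← Finset.mul_sum, Finset.sum_add_distrib, Finset.sum_add_distrib,
    ← Finset.card_filter, ← Finset.card_filter, Finset.sum_const, smul_eq_mul] at hsum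
  change E e + _ ≤ E o + _ at hsum
  omega

theorem exists_leastOverlap {T : ArborealAction G V} {o : V} {P Q : Finset G} {x : G}
    (h : ∃ κ h, T.Overlap o P Q x κ h) : ∃ κ h, T.LeastOverlap o P Q x κ h := by
  classical
  obtain ⟨k, hk⟩ := Nat.find_spec h
  exact ⟨Nat.find h, k, hk, fun κ' h' ho => Nat.find_min' h ⟨h', ho⟩⟩

/-- **Tripling in groups acting on trees.** A finite set that fixes no vertex and stabilizes no
line has large triple product set. -/
theorem card_sq_le_card_pow_three [DecidableEq G] [Nonempty V] (A : Finset G)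
    (hfix : ∀ v : V, ∃ a ∈ A, a • v ≠ v)
    (haxis : ∀ h κ ℓ, T.Axis h κ ℓ →
      ¬ (A : Set G) ⊆ MulAction.stabilizer G (Set.range ℓ)) :
    A.card ^ 2 ≤ 7776 * (A ^ 3).card := by
  classical
  by_contra! hlt
  obtain ⟨o, ho⟩ := T.exists_central_vertex A
  obtain ⟨y, hyA, hyo⟩ := hfix o
  have hAne : A.Nonempty := ⟨y, hyA⟩
  have hcube : ∀ a ∈ A, ∀ x ∈ A, ∀ b ∈ A, a * x * b ∈ A ^ 3 := by
    intro a ha x hx b hb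
    rw [pow_succ, sq]
    exact Finset.mul_mem_mul (Finset.mul_mem_mul ha hx) hb
  have hA3 : A.card ≤ (A ^ 3).card := by
    rw [pow_succ A 2, sq]
    exact Finset.card_le_card_mul_left (hAne.mul hAne)
  have hN : 7776 ≤ A.card := by
    by_contra! hN
    nlinarith
  set Z := A.filter fun a => T.dir o (a • o) = o with hZ
  have hZmem : ∀ a ∈ Z, a ∈ A ∧ a • o = o := fun a ha => by
    rw [hZ, Finset.mem_filter, T.dir_eq_self_iff] at ha
    exact ha
  -- For `a, b` fixing `o`, the product `a * y * b` sends `o` to `a • y • o`. This determines `a`,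
  -- because only `1` fixes both `o` and `y • o`.
  have hZsq : Z.card ^ 2 ≤ (A ^ 3).card := by
    rw [sq, ← Finset.card_product]
    refine Finset.card_le_card_of_injOn (fun p => p.1 * y * p.2) ?_ ?_
    · rintro ⟨a, b⟩ hp
      have hp := Finset.mem_product.mp hp
      exact hcube a (hZmem a hp.1).1 y hyA b (hZmem b hp.2).1
    · rintro ⟨a, b⟩ hp ⟨a', b'⟩ hp' he
      have hp := Finset.mem_product.mp hp
      have hp' := Finset.mem_product.mp hp'
      dsimp only at hp hp' he
      have e1 : a • o = a' • o := (hZmem _ hp.1).2.trans (hZmem _ hp'.1).2.symm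
      have e2 : a • y • o = a' • y • o := by
        have := congrArg (· • o) he
        simpa only [mul_smul, (hZmem _ hp.2).2, (hZmem _ hp'.2).2] using this
      have e3 : a = a' := T.eq_of_smul_eq (Ne.symm hyo) e1 e2
      subst e3
      rw [mul_left_cancel he]
  have hZc : 88 * Z.card < A.card := by
    by_contra! hle
    nlinarith
  have hiff : ∀ a : G, T.dir o (a⁻¹ • o) = o ↔ T.dir o (a • o) = o := fun a => by
    rw [T.dir_eq_self_iff, T.dir_eq_self_iff, inv_smul_eq_iff, eq_comm]
  have hcount : ∀ e, (A.filter fun a => T.dir o (a • o) = e).card +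
      (A.filter fun a => T.dir o (a⁻¹ • o) = e).card ≤ A.card := by
    intro e
    by_cases he : T.dist o e = 1
    · exact ho e he
    by_cases heo : e = o
    · subst heo
      rw [Finset.filter_congr fun a _ => hiff a]
      change Z.card + Z.card ≤ A.card
      omega
    · have hne : ∀ v, T.dir o v ≠ e := by
        intro v hv
        by_cases hov : o = v
        · rw [← hov, T.dir_self] at hv
          exact heo hv.symm
        · exact he (hv ▸ (T.dist_dir hov).1)
      simp [hne]
  obtain ⟨P, hP, X, hX, Q, hQ, hPX, hXQ, hXo, hlen, hXc, hPQ⟩ :=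
    A.exists_directed_triple (fun a => T.dir o (a • o)) (fun a => T.dir o (a⁻¹ • o)) o
      (fun a => T.dist o (a • o)) hN hZc hiff hcount
  have hal : ∀ x ∈ X, T.Aligned o P Q x := fun x hx =>
    ⟨fun h => hXo x hx (T.dir_eq_self_iff.mpr h.symm), fun a ha => T.btw_of_dir_ne (hPX a ha x hx),
      fun b hb => T.btw_of_dir_ne (hXQ x hx b hb)⟩
  have hov : ∀ x ∈ X, ∀ P' ⊆ P, ∀ Q' ⊆ Q, P.card * Q.card ≤ 4 * (P'.card * Q'.card) →
      ∃ κ h, T.Overlap o P' Q' x κ h := by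
    intro x hx P' hP' Q' hQ' hc
    -- Without overlaps, `|P'||Q'| ≤ 3|A³|`, hence `|A|² ≤ 648 · 4 · 3 · |A³|`, against `hlt`.
    by_contra! hno
    have h1 := ((hal x hx).mono hP' hQ').card_mul_card_le
      (fun a ha => hlen a (hP' ha) x hx) hno
    have h2 : ((P' ×ˢ Q').image fun p => p.1 * x * p.2).card ≤ (A ^ 3).card := by
      refine Finset.card_le_card ?_
      intro g hg
      simp only [Finset.mem_image, Finset.mem_product] at hg
      obtain ⟨p, ⟨ha, hb⟩, rfl⟩ := hg
      exact hcube _ (hP (hP' ha)) _ (hX hx) _ (hQ (hQ' hb))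
    omega
  have hleast : ∀ x ∈ X, ∃ κ h, T.LeastOverlap o P Q x κ h := fun x hx =>
    exists_leastOverlap (hov x hx P (subset_refl _) Q (subset_refl _) (by omega))
  obtain ⟨x₀, hx₀⟩ : X.Nonempty := by
    rw [← Finset.card_pos]; omega
  obtain ⟨κ, h, hl⟩ := hleast x₀ hx₀
  obtain ⟨ℓ, hℓ, -, -⟩ := (hal x₀ hx₀).exists_axis hl.overlap
  have hcent : ∀ y ∈ X, ∃ m : ℕ, 0 < m ∧ Commute (y * x₀⁻¹) (h ^ m) := by
    intro y hy
    obtain ⟨κ', h', hl'⟩ := hleast y hy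
    exact ⟨κ', hl.commute (hal x₀ hx₀) (hal y hy) hl' fun P' hP' Q' hQ' hc =>
      ⟨hov x₀ hx₀ P' hP' Q' hQ' hc, hov y hy P' hP' Q' hQ' hc⟩⟩
  have hXsq := hℓ.card_sq_le hX hcent (haxis h κ ℓ hℓ)
  nlinarith

end ArborealAction

/-! ### The prefix tree of lists -/

namespace List

variable {α : Type*} [DecidableEq α]

/-- The length of the longest common prefix. -/
def lcp : List α → List α → ℕ
  | a :: l, b :: l' => if a = b then lcp l l' + 1 else 0
  | _, _ => 0

/-- The distance of two lists in the prefix tree. -/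
def treeDist (l l' : List α) : ℕ := l.length + l'.length - 2 * lcp l l'

@[simp] theorem lcp_nil_left (l : List α) : lcp [] l = 0 := by cases l <;> rfl

@[simp] theorem lcp_nil_right (l : List α) : lcp l [] = 0 := by cases l <;> rfl

theorem lcp_cons (a b : α) (l l' : List α) :
    lcp (a :: l) (b :: l') = if a = b then lcp l l' + 1 else 0 := rfl

theorem lcp_comm (l l' : List α) : lcp l l' = lcp l' l := by
  induction l generalizing l' with
  | nil => simp
  | cons a l ih =>
    cases l' with
    | nil => simp
    | cons b l' => simp only [lcp_cons, ih, eq_comm]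

theorem lcp_self (l : List α) : lcp l l = l.length := by
  induction l with
  | nil => rfl
  | cons a l ih => simp [lcp_cons, ih]

theorem lcp_le_left (l l' : List α) : lcp l l' ≤ l.length := by
  induction l generalizing l' with
  | nil => simp
  | cons a l ih =>
    cases l' with
    | nil => simp
    | cons b l' =>
      rw [lcp_cons]
      split_ifs
      · simpa using ih l'
      · simp

theorem lcp_le_right (l l' : List α) : lcp l l' ≤ l'.length := by
  rw [lcp_comm]; exact lcp_le_left l' l

/-- Common prefixes obey the ultrametric inequality; the triangle inequality and the four-point
condition for `treeDist` rest on it. -/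
theorem min_lcp_le (l l' l'' : List α) : lcp l l' ≤ lcp l l'' ∨ lcp l' l'' ≤ lcp l l'' := by
  induction l generalizing l' l'' with
  | nil => simp
  | cons a l ih =>
    rcases l' with _ | ⟨b, l'⟩
    · simp
    rcases l'' with _ | ⟨c, l''⟩
    · simp
    have := ih l' l''
    simp only [lcp_cons]
    split_ifs <;> simp_all

theorem treeDist_add (l l' : List α) :
    treeDist l l' + 2 * lcp l l' = l.length + l'.length := by
  have h1 := lcp_le_left l l'
  have h2 := lcp_le_right l l'
  unfold treeDist
  omega

theorem treeDist_comm (l l' : List α) : treeDist l l' = treeDist l' l := by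
  have h1 := treeDist_add l l'
  have h2 := treeDist_add l' l
  rw [lcp_comm] at h2
  omega

theorem treeDist_self (l : List α) : treeDist l l = 0 := by
  have h1 := treeDist_add l l
  rw [lcp_self] at h1
  omega

theorem eq_of_treeDist_eq_zero {l l' : List α} (h : treeDist l l' = 0) : l = l' := by
  have h1 := treeDist_add l l'
  have h2 := lcp_le_left l l'
  have h3 := lcp_le_right l l'
  have h4 : lcp l l' = l.length := by omega
  have h5 : l.length = l'.length := by omega
  clear h h1 h2 h3
  induction l generalizing l' with
  | nil => exact (length_eq_zero_iff.mp h5.symm).symm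
  | cons a l ih =>
    rcases l' with _ | ⟨b, l'⟩
    · simp at h5
    · rw [lcp_cons] at h4
      split_ifs at h4 with hab
      · rw [hab, ih (by simpa using h4) (by simpa using h5)]

theorem treeDist_triangle (l l' l'' : List α) :
    treeDist l l'' ≤ treeDist l l' + treeDist l' l'' := by
  have h1 := treeDist_add l l'
  have h2 := treeDist_add l' l''
  have h3 := treeDist_add l l''
  have h4 := min_lcp_le l l' l''
  have h5 := lcp_le_right l l'
  have h6 := lcp_le_left l' l''
  omega

theorem treeDist_even (l l' l'' : List α) :
    Even (treeDist l l' + treeDist l' l'' + treeDist l l'') := by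
  have h1 := treeDist_add l l'
  have h2 := treeDist_add l' l''
  have h3 := treeDist_add l l''
  rw [Nat.even_iff]
  omega

theorem treeDist_four_point (u v w z : List α) :
    treeDist u v + treeDist w z ≤
      max (treeDist u w + treeDist v z) (treeDist u z + treeDist v w) := by
  have e1 := treeDist_add u v
  have e2 := treeDist_add w z
  have e3 := treeDist_add u w
  have e4 := treeDist_add v z
  have e5 := treeDist_add u z
  have e6 := treeDist_add v w
  have u1 := min_lcp_le u w v
  have u2 := min_lcp_le u z v
  have u3 := min_lcp_le w u z
  have u4 := min_lcp_le w v z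
  have u5 := min_lcp_le u w z
  have u6 := min_lcp_le u v z
  have u7 := min_lcp_le v w z
  have u8 := min_lcp_le v u z
  have u9 := min_lcp_le u z w
  have u10 := min_lcp_le u v w
  have u11 := min_lcp_le v u w
  have u12 := min_lcp_le v z w
  simp only [lcp_comm w u, lcp_comm w v, lcp_comm z v, lcp_comm z w,
    lcp_comm v u] at *
  omega

theorem treeDist_cons_self (a : α) (l l' : List α) :
    treeDist (a :: l) (a :: l') = treeDist l l' := by
  have h1 := treeDist_add (a :: l) (a :: l')
  have h2 := treeDist_add l l'
  rw [lcp_cons, if_pos rfl] at h1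
  simp only [length_cons] at h1
  omega

theorem treeDist_cons_cons {a b : α} (hab : a ≠ b) (l l' : List α) :
    treeDist (a :: l) (b :: l') = l.length + l'.length + 2 := by
  have h1 := treeDist_add (a :: l) (b :: l')
  rw [lcp_cons, if_neg hab] at h1
  simp only [length_cons] at h1
  omega

theorem treeDist_nil_left (l : List α) : treeDist [] l = l.length := by
  simp [treeDist]

theorem treeDist_nil_right (l : List α) : treeDist l [] = l.length := by
  simp [treeDist]

theorem treeDist_dropLast (a : α) (l : List α) : treeDist (a :: l) (a :: l).dropLast = 1 := by
  induction l generalizing a with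
  | nil => simp [treeDist_nil_right]
  | cons b l ih => rw [dropLast_cons_of_ne_nil (by simp), treeDist_cons_self, ih]

/-- The step is a prefix of `u` or of `v`, so it stays inside any prefix-closed set of lists, such
as the paths of Bass–Serre vertices. -/
theorem exists_treeDist_step {u v : List α} (h : u ≠ v) :
    ∃ w, (w <+: u ∨ w <+: v) ∧ treeDist u w = 1 ∧ treeDist w v + 1 = treeDist u v := by
  induction u generalizing v with
  | nil =>
    rcases v with _ | ⟨b, v⟩
    · exact absurd rfl h
    · refine ⟨[b], Or.inr (by simp), by simp [treeDist_nil_left], ?_⟩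
      rw [treeDist_cons_self, treeDist_nil_left, treeDist_nil_left, length_cons]
  | cons a u ih =>
    by_cases hv : ∃ v', v = a :: v'
    · obtain ⟨v, rfl⟩ := hv
      obtain ⟨w, hw, h1, h2⟩ := ih (v := v) (by rintro rfl; exact h rfl)
      refine ⟨a :: w, ?_, by rwa [treeDist_cons_self], by rwa [treeDist_cons_self,
        treeDist_cons_self]⟩
      simpa using hw
    · refine ⟨(a :: u).dropLast, Or.inl (dropLast_prefix _), treeDist_dropLast a u, ?_⟩
      have key : ∀ u' : List α, treeDist (a :: u') v = u'.length + 1 + v.length := by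
        intro u'
        rcases v with _ | ⟨b, v⟩
        · simp [treeDist_nil_right]
        · rw [treeDist_cons_cons (by rintro rfl; exact hv ⟨v, rfl⟩), length_cons]; omega
      rcases u with _ | ⟨b, u⟩
      · rw [key, dropLast_singleton, treeDist_nil_left]; simp; omega
      · rw [dropLast_cons_of_ne_nil (by simp), key, key, length_dropLast]; simp; omega

end List

/-! ### The Bass–Serre tree of a free product -/

namespace Monoid.CoprodI

open Word List

variable {ι : Type*} {G : ι → Type*}

section Path

variable [DecidableEq ι]

/-- The path from the base vertex of the Bass–Serre tree of a free product to the vertex given by a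
reduced word (for `none`), or by its coset modulo the `i`-th factor (for `some i`). -/
def vertexPath : List (Σ i, G i) → Option ι → List (ι ⊕ Σ i, G i)
  | [], none => []
  | [], some j => [Sum.inl j]
  -- A last syllable in the factor `o` does not change the coset, so the path stops before it.
  | s :: l, o => if l = [] ∧ o = some s.1 then [Sum.inl s.1]
      else Sum.inl s.1 :: Sum.inr s :: vertexPath l o

theorem vertexPath_cons (s : Σ i, G i) (l : List (Σ i, G i)) (o : Option ι) :
    vertexPath (s :: l) o = if l = [] ∧ o = some s.1 then [Sum.inl s.1]
      else Sum.inl s.1 :: Sum.inr s :: vertexPath l o := by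
  rw [vertexPath]

theorem vertexPath_head {l : List (Σ i, G i)} {o : Option ι} {a : ι ⊕ Σ i, G i}
    {r : List (ι ⊕ Σ i, G i)} (h : vertexPath l o = a :: r) :
    (l = [] ∧ ∃ j, o = some j ∧ a = Sum.inl j) ∨ ∃ s l', l = s :: l' ∧ a = Sum.inl s.1 := by
  rcases l with _ | ⟨s, l⟩
  · rcases o with _ | j
    · simp [vertexPath] at h
    · simp only [vertexPath, cons.injEq] at h
      exact Or.inl ⟨rfl, j, rfl, h.1.symm⟩
  · refine Or.inr ⟨s, l, rfl, ?_⟩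
    rw [vertexPath_cons] at h
    split_ifs at h <;> simp only [cons.injEq] at h <;> exact h.1.symm

/-- Parity separates elements from cosets. The action preserves this type, hence displacements are
even, and every edge has an element as one end. -/
theorem even_length_vertexPath (l : List (Σ i, G i)) (o : Option ι) :
    Even (vertexPath l o).length ↔ o = none := by
  induction l with
  | nil => cases o <;> simp [vertexPath]
  | cons s l ih =>
    rw [vertexPath_cons]
    split_ifs with h
    · simp [h.2]
    · rw [length_cons, length_cons, ← ih, Nat.even_add_one, Nat.even_add_one, not_not]

theorem vertexPath_none_injective :
    Function.Injective fun l : List (Σ i, G i) => vertexPath l none := by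
  intro l
  induction l with
  | nil =>
    intro l' h
    cases l' with
    | nil => rfl
    | cons s l' => simp [vertexPath] at h
  | cons s l ih =>
    intro l' h
    cases l' with
    | nil => simp [vertexPath] at h
    | cons s' l' =>
      simp only [vertexPath_cons, reduceCtorEq, and_false, if_false, cons.injEq,
        Sum.inr.injEq] at h
      rw [h.2.1, ih h.2.2]

theorem exists_of_prefix_vertexPath {l : List (Σ i, G i)} {o : Option ι}
    (hl : l.IsChain fun s s' => s.1 ≠ s'.1) {r : List (ι ⊕ Σ i, G i)}
    (hr : r <+: vertexPath l o) : ∃ l' o', l' <+: l ∧ r = vertexPath l' o' := by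
  induction l generalizing r with
  | nil =>
    rcases r with _ | ⟨a, r⟩
    · exact ⟨[], none, prefix_refl _, rfl⟩
    · rcases o with _ | j
      · simp [vertexPath] at hr
      · simp only [vertexPath, cons_prefix_cons, prefix_nil] at hr
        exact ⟨[], some j, prefix_refl _, by rw [hr.1, hr.2]; rfl⟩
  | cons s l ih =>
    rcases r with _ | ⟨a, r⟩
    · exact ⟨[], none, nil_prefix, rfl⟩
    rw [vertexPath_cons] at hr
    split_ifs at hr with h
    · rw [cons_prefix_cons, prefix_nil] at hr
      exact ⟨[], some s.1, nil_prefix, by rw [hr.1, hr.2]; rfl⟩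
    rw [cons_prefix_cons] at hr
    obtain ⟨rfl, hr⟩ := hr
    rcases r with _ | ⟨b, r⟩
    · exact ⟨[], some s.1, nil_prefix, rfl⟩
    rw [cons_prefix_cons] at hr
    obtain ⟨rfl, hr⟩ := hr
    obtain ⟨l', o', hl', rfl⟩ := ih hl.tail hr
    refine ⟨s :: l', o', by simpa using hl', ?_⟩
    rw [vertexPath_cons, if_neg]
    rintro ⟨rfl, rfl⟩
    obtain ⟨t, ht⟩ := hr
    rcases vertexPath_head (l := l) (o := o) ht.symm with ⟨h1, j, h2, h3⟩ | ⟨s', l', h1, h2⟩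
    · exact h ⟨h1, h2.trans (congrArg some (Sum.inl.inj h3).symm)⟩
    · subst h1
      rw [isChain_cons_cons] at hl
      exact hl.1 (Sum.inl.inj h2)

end Path

variable [∀ i, Group (G i)] [DecidableEq ι]

variable (G) in
/-- The vertices of the Bass–Serre tree of a free product: the elements of the free product, and
the cosets of the factors. -/
def BassSerreVertex : Type _ :=
  Quotient (Setoid.ker fun p : Word G × Option ι => vertexPath p.1.toList p.2)

namespace BassSerreVertex

/-- The path from the base vertex. -/
def path (v : BassSerreVertex G) : List (ι ⊕ Σ i, G i) :=
  Quotient.lift (s := Setoid.ker fun p : Word G × Option ι => vertexPath p.1.toList p.2)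
    (fun p : Word G × Option ι => vertexPath p.1.toList p.2) (fun _ _ h => h) v

/-- The vertex given by a reduced word, or by its coset modulo a factor. -/
def mk (w : Word G) (o : Option ι) : BassSerreVertex G :=
  Quotient.mk (Setoid.ker fun p : Word G × Option ι => vertexPath p.1.toList p.2) (w, o)

theorem path_mk (w : Word G) (o : Option ι) : (mk w o).path = vertexPath w.toList o := rfl

theorem exists_mk (v : BassSerreVertex G) : ∃ w o, v = mk w o := by
  obtain ⟨⟨w, o⟩, rfl⟩ := Quotient.exists_rep v
  exact ⟨w, o, rfl⟩

theorem path_injective : Function.Injective (path : BassSerreVertex G → _) := by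
  rintro ⟨p⟩ ⟨q⟩ h
  exact Quotient.sound h

theorem exists_of_prefix_path {v : BassSerreVertex G} {r : List (ι ⊕ Σ i, G i)}
    (hr : r <+: v.path) : ∃ u : BassSerreVertex G, u.path = r := by
  obtain ⟨w, o, rfl⟩ := exists_mk v
  obtain ⟨l, o', ⟨t, ht⟩, rfl⟩ := exists_of_prefix_vertexPath w.chain_ne hr
  have hc := w.chain_ne
  rw [← ht] at hc
  exact ⟨mk ⟨l, fun s hs => w.ne_one s (by rw [← ht]; exact mem_append_left _ hs),
    hc.left_of_append⟩ o', rfl⟩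

instance : Nonempty (BassSerreVertex G) := ⟨mk Word.empty none⟩

end BassSerreVertex

variable [∀ i, DecidableEq (G i)]

/-- The path to the vertex given by `w` and `o` from the vertex of the `i`-th factor. -/
def factorPath (i : ι) (w : Word G) (o : Option ι) : List (ι ⊕ Σ i, G i) :=
  if (equivPair i w).tail.toList = [] ∧ o = some i then []
  else Sum.inr ⟨i, (equivPair i w).head⟩ :: vertexPath (equivPair i w).tail.toList o

/-- The two encodings differ by rerooting the tree across the edge from the base vertex to the
`i`-th factor. The cases tell on which side of that edge the vertex lies. -/
theorem vertexPath_eq_factorPath (i : ι) (w : Word G) (o : Option ι) :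
    (vertexPath w.toList o = Sum.inl i :: factorPath i w o ∧
      ∀ r, factorPath i w o ≠ Sum.inr ⟨i, 1⟩ :: r) ∨
    ((∀ r, vertexPath w.toList o ≠ Sum.inl i :: r) ∧
      factorPath i w o = Sum.inr ⟨i, 1⟩ :: vertexPath w.toList o) := by
  obtain ⟨p, rfl⟩ := (equivPair i).symm.surjective w
  unfold factorPath
  rw [Equiv.apply_symm_apply, equivPair_symm]
  by_cases hp : p.head = 1
  · have hw : rcons p = p.tail := by rw [rcons, dif_pos hp]
    rw [hw, hp]
    split_ifs with h
    · left
      rw [h.1, h.2]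
      exact ⟨rfl, by simp⟩
    · right
      refine ⟨fun r hr => ?_, rfl⟩
      rcases vertexPath_head hr with ⟨h1, j, h2, h3⟩ | ⟨s, l, h1, h2⟩
      · exact h ⟨h1, h2.trans (congrArg some (Sum.inl.inj h3).symm)⟩
      · refine p.fstIdx_ne ?_
        rw [fstIdx, h1, head?_cons, Option.map_some, Sum.inl.inj h2]
  · have hw : (rcons p).toList = ⟨i, p.head⟩ :: p.tail.toList := by
      simp [rcons, hp, Word.cons]
    left
    rw [hw, vertexPath_cons]
    split_ifs with h
    · exact ⟨rfl, by simp⟩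
    · refine ⟨rfl, fun r hr => hp ?_⟩
      exact (by simpa using hr : p.head = 1 ∧ _).1

theorem treeDist_vertexPath (i : ι) (w w' : Word G) (o o' : Option ι) :
    treeDist (vertexPath w.toList o) (vertexPath w'.toList o') =
      treeDist (factorPath i w o) (factorPath i w' o') := by
  have key : ∀ (a : ι ⊕ Σ i, G i) (u v : List (ι ⊕ Σ i, G i)),
      (∀ r, u ≠ a :: r) → treeDist (a :: v) u = v.length + 1 + u.length := by
    intro a u v hu
    rcases u with _ | ⟨b, u⟩
    · simp [treeDist_nil_right]
    · rw [treeDist_cons_cons (by rintro rfl; exact hu u rfl), length_cons]; omega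
  rcases vertexPath_eq_factorPath i w o with ⟨h1, h2⟩ | ⟨h1, h2⟩ <;>
    rcases vertexPath_eq_factorPath i w' o' with ⟨h1', h2'⟩ | ⟨h1', h2'⟩
  · rw [h1, h1', treeDist_cons_self]
  · rw [h1, h2', key _ _ _ h1', treeDist_comm, key _ _ _ h2]; omega
  · rw [h2, h1', key _ _ _ h2', treeDist_comm, key _ _ _ h1]; omega
  · rw [h2, h2', treeDist_cons_self]

/-- Seen from the vertex of the `i`-th factor, which `of m` fixes, the action only multiplies the
first letter by `m`. -/
theorem treeDist_factorPath_smul (i : ι) (m : G i) (w w' : Word G) (o o' : Option ι) :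
    treeDist (factorPath i (of m • w) o) (factorPath i (of m • w') o') =
      treeDist (factorPath i w o) (factorPath i w' o') := by
  unfold factorPath
  rw [equivPair_smul_same, equivPair_smul_same]
  dsimp only
  split_ifs
  · rfl
  · simp [treeDist_nil_left]
  · simp [treeDist_nil_right]
  · by_cases h : (equivPair i w).head = (equivPair i w').head
    · rw [h, treeDist_cons_self, treeDist_cons_self]
    · rw [treeDist_cons_cons (by simpa using h), treeDist_cons_cons (by simpa using h)]

theorem treeDist_vertexPath_smul (g : CoprodI G) (w w' : Word G) (o o' : Option ι) :
    treeDist (vertexPath (g • w).toList o) (vertexPath (g • w').toList o') =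
      treeDist (vertexPath w.toList o) (vertexPath w'.toList o') := by
  induction g using CoprodI.induction_on generalizing w w' with
  | one => rw [one_smul, one_smul]
  | of i m => rw [treeDist_vertexPath i, treeDist_factorPath_smul, ← treeDist_vertexPath i]
  | mul x y hx hy => rw [mul_smul, mul_smul, hx, hy]

namespace BassSerreVertex

instance : MulAction (CoprodI G) (BassSerreVertex G) where
  smul g := Quotient.map (fun p => (g • p.1, p.2)) (by
    rintro ⟨w, o⟩ ⟨w', o'⟩ h
    have h : vertexPath w.toList o = vertexPath w'.toList o' := h
    -- Left multiplication respects equality of cosets because it preserves distances, in particular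
    -- distance zero.
    refine eq_of_treeDist_eq_zero ?_
    dsimp only
    rw [treeDist_vertexPath_smul, h, treeDist_self])
  one_smul := by
    rintro ⟨w, o⟩
    exact congrArg (fun w => mk w o) (one_smul _ w)
  mul_smul := by
    rintro g g' ⟨w, o⟩
    exact congrArg (fun w => mk w o) (mul_smul g g' w)

theorem smul_mk (g : CoprodI G) (w : Word G) (o : Option ι) : g • mk w o = mk (g • w) o := rfl

theorem treeDist_path_smul (g : CoprodI G) (u v : BassSerreVertex G) :
    treeDist (g • u).path (g • v).path = treeDist u.path v.path := by
  obtain ⟨w, o, rfl⟩ := exists_mk u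
  obtain ⟨w', o', rfl⟩ := exists_mk v
  exact treeDist_vertexPath_smul g w w' o o'

theorem eq_one_of_smul_eq {g : CoprodI G} {w : Word G} (h : g • mk w none = mk w none) :
    g = 1 := by
  have h1 : (g • mk w none).path = (mk w none).path := by rw [h]
  have h2 : g • w = w := Word.ext (vertexPath_none_injective h1)
  have h3 := prod_smul g w
  rw [h2] at h3
  exact (mul_eq_right.mp h3.symm)

/-- The action of a free product on its Bass–Serre tree. -/
def action : ArborealAction (CoprodI G) (BassSerreVertex G) where
  dist u v := treeDist u.path v.path
  dist_self u := treeDist_self _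
  eq_of_dist_eq_zero h := path_injective (eq_of_treeDist_eq_zero h)
  dist_comm u v := treeDist_comm _ _
  dist_triangle u v w := treeDist_triangle _ _ _
  four_point u v w z := treeDist_four_point _ _ _ _
  exists_step u v h := by
    obtain ⟨r, hr, h1, h2⟩ := exists_treeDist_step fun h' => h (path_injective h')
    obtain ⟨w, rfl⟩ : ∃ w : BassSerreVertex G, w.path = r :=
      hr.elim exists_of_prefix_path exists_of_prefix_path
    exact ⟨w, h1, h2⟩
  even_perimeter u v w := treeDist_even _ _ _
  dist_smul := treeDist_path_smul
  even_displacement g u := by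
    obtain ⟨w, o, rfl⟩ := exists_mk u
    have h := treeDist_add (mk w o).path (g • mk w o).path
    have h1 := even_length_vertexPath w.toList o
    rw [← even_length_vertexPath (g • w).toList o] at h1
    rw [smul_mk] at h ⊢
    rw [path_mk, path_mk] at h ⊢
    rw [Nat.even_iff, Nat.even_iff] at h1
    rw [Nat.even_iff]
    omega
  edge_stabilizer g u v h hu hv := by
    obtain ⟨w, o, rfl⟩ := exists_mk u
    obtain ⟨w', o', rfl⟩ := exists_mk v
    have h0 := treeDist_add (mk w o).path (mk w' o').path
    rw [path_mk, path_mk] at h h0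
    have h1 := even_length_vertexPath w.toList o
    have h2 := even_length_vertexPath w'.toList o'
    by_cases ho : o = none
    · subst ho; exact eq_one_of_smul_eq hu
    by_cases ho' : o' = none
    · subst ho'; exact eq_one_of_smul_eq hv
    exfalso
    rw [← h1, Nat.even_iff] at ho
    rw [← h2, Nat.even_iff] at ho'
    omega

/-- Vertex stabilizers are trivial or conjugate into a factor. -/
theorem stabilizer_le (v : BassSerreVertex G) :
    MulAction.stabilizer (CoprodI G) v = ⊥ ∨
      ∃ (u : CoprodI G) (i : ι), ∀ g ∈ MulAction.stabilizer (CoprodI G) v,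
        u⁻¹ * g * u ∈ (of : G i →* CoprodI G).range := by
  obtain ⟨w, o, rfl⟩ := exists_mk v
  rcases o with _ | i
  · left
    rw [eq_bot_iff]
    exact fun g hg => eq_one_of_smul_eq hg
  · right
    refine ⟨w.prod, i, fun g hg => ?_⟩
    rw [MulAction.mem_stabilizer_iff] at hg
    have hw : mk w (some i) = w.prod • mk Word.empty (some i) := by
      rw [smul_mk]; exact congrArg (fun w => mk w (some i)) (Word.equiv.right_inv w).symm
    rw [hw, ← mul_smul, ← inv_smul_eq_iff, ← mul_smul, ← mul_assoc] at hg
    set k := w.prod⁻¹ * g * w.prod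
    -- Fixing the base coset of the `i`-th factor forces the reduced word of `k` to be empty or a
    -- single syllable in that factor.
    have hp : vertexPath (k • Word.empty : Word G).toList (some i) = [Sum.inl i] :=
      congrArg path hg
    have hk : (k • Word.empty : Word G).prod = k := by rw [prod_smul, prod_empty, mul_one]
    rw [← hk, Word.prod]
    rcases hl : (k • Word.empty : Word G).toList with _ | ⟨s, l⟩
    · exact one_mem _
    · rw [hl, vertexPath_cons] at hp
      split_ifs at hp with h
      · obtain ⟨rfl, h⟩ := h
        obtain ⟨j, m⟩ := s
        obtain rfl : i = j := Option.some.inj h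
        exact ⟨m, by simp⟩
      · simp at hp

end BassSerreVertex

end Monoid.CoprodI

/-! ### Virtual properties of subgroups and the conclusion -/

namespace Group

variable {H K : Type*} [Group H] [Group K]

theorem finiteIndex_comap (f : H →* K) (N : Subgroup K) (hN : N.FiniteIndex) :
    (N.comap f).FiniteIndex :=
  ⟨by
    have := Subgroup.relIndex_comap_ne_zero f (J := N) (K := ⊤) (by
      rw [Subgroup.relIndex_top_right]; exact hN.index_ne_zero)
    rwa [Subgroup.comap_top, Subgroup.relIndex_top_right] at this⟩

theorem subgroupComap_injective {f : H →* K} (hf : Function.Injective f) (N : Subgroup K) :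
    Function.Injective (f.subgroupComap N) := fun _ _ h =>
  Subtype.ext (hf (congrArg Subtype.val h))

theorem IsVirtuallyCyclic.of_injective {f : H →* K} (hf : Function.Injective f)
    (h : IsVirtuallyCyclic K) : IsVirtuallyCyclic H := by
  obtain ⟨N, hN, hfin⟩ := h
  exact ⟨N.comap f, isCyclic_of_injective _ (subgroupComap_injective hf N),
    finiteIndex_comap f N hfin⟩

theorem IsVirtuallyAbelian.of_injective {f : H →* K} (hf : Function.Injective f)
    (h : IsVirtuallyAbelian K) : IsVirtuallyAbelian H := by
  obtain ⟨N, hN, hfin⟩ := h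
  refine ⟨N.comap f, ⟨⟨fun a b => subgroupComap_injective hf N ?_⟩⟩, finiteIndex_comap f N hfin⟩
  rw [map_mul, map_mul]
  exact hN.is_comm.comm _ _

theorem IsVirtuallyNilpotent.of_injective {f : H →* K} (hf : Function.Injective f)
    (h : IsVirtuallyNilpotent K) : IsVirtuallyNilpotent H := by
  obtain ⟨N, hN, hfin⟩ := h
  refine ⟨N.comap f, ?_, finiteIndex_comap f N hfin⟩
  refine Subgroup.isNilpotent_of_ker_le_center (f.subgroupComap N) ?_
  rw [(MonoidHom.ker_eq_bot_iff _).mpr (subgroupComap_injective hf N)]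
  exact bot_le

theorem IsVirtuallyCyclic.isVirtuallyAbelian (h : IsVirtuallyCyclic H) : IsVirtuallyAbelian H := by
  obtain ⟨N, hN, hfin⟩ := h
  exact ⟨N, inferInstance, hfin⟩

theorem IsVirtuallyAbelian.isVirtuallyNilpotent (h : IsVirtuallyAbelian H) :
    IsVirtuallyNilpotent H := by
  obtain ⟨N, hN, hfin⟩ := h
  let _ : CommGroup N := { (inferInstance : Group N) with mul_comm := hN.is_comm.comm }
  exact ⟨N, CommGroup.isNilpotent, hfin⟩

end Group

/-- **Tripling in free products.** A finite subset of a free product has large triple product set,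
unless it generates a virtually cyclic subgroup or a subgroup conjugate into a factor. -/
theorem Monoid.CoprodI.card_sq_le_card_pow_three {ι : Type*} {G : ι → Type*} [∀ i, Group (G i)]
    [DecidableEq (Monoid.CoprodI G)] (A : Finset (Monoid.CoprodI G)) :
    A.card ^ 2 ≤ 7776 * (A ^ 3).card ∨
      Group.IsVirtuallyCyclic (Subgroup.closure (A : Set (Monoid.CoprodI G))) ∨
      ∃ (i : ι) (f : Subgroup.closure (A : Set (Monoid.CoprodI G)) →* G i),
        Function.Injective f := by
  classical
  by_cases hfix : ∀ v : BassSerreVertex G, ∃ a ∈ A, a • v ≠ v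
  · by_cases haxis : ∀ h κ ℓ, (BassSerreVertex.action (G := G)).Axis h κ ℓ →
        ¬ (A : Set (Monoid.CoprodI G)) ⊆ MulAction.stabilizer (Monoid.CoprodI G) (Set.range ℓ)
    · exact Or.inl (BassSerreVertex.action.card_sq_le_card_pow_three A hfix haxis)
    · push Not at haxis
      obtain ⟨h, κ, ℓ, ha, hA⟩ := haxis
      have hle := (Subgroup.closure_le _).mpr hA
      exact Or.inr (Or.inl (ha.isVirtuallyCyclic_stabilizer.of_injective
        (Subgroup.inclusion_injective hle)))
  · push Not at hfix
    obtain ⟨v, hv⟩ := hfix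
    have hle : Subgroup.closure (A : Set (Monoid.CoprodI G)) ≤
        MulAction.stabilizer (Monoid.CoprodI G) v :=
      (Subgroup.closure_le _).mpr fun a ha => hv a ha
    right
    rcases BassSerreVertex.stabilizer_le v with h | ⟨u, i, h⟩
    · left
      rw [h, le_bot_iff] at hle
      rw [hle]
      exact ⟨⊤, inferInstance, inferInstance⟩
    · right
      let e := MonoidHom.ofInjective (of_injective (M := G) i)
      let c : Subgroup.closure (A : Set (Monoid.CoprodI G)) →* (of : G i →* CoprodI G).range :=
        ((MulAut.conj u⁻¹).toMonoidHom.comp (Subgroup.subtype _)).codRestrict _ fun g => by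
          simpa using h g (hle g.2)
      refine ⟨i, e.symm.toMonoidHom.comp c, e.symm.injective.comp fun a b hab => ?_⟩
      have := congrArg Subtype.val hab
      exact Subtype.ext ((MulAut.conj u⁻¹).injective this)

theorem corollary2p13 {n : ℕ} (G : Fin n → Type*) [∀ i, Group (G i)]
    [DecidableEq (Monoid.CoprodI G)] :
    ((∀ i, Group.IsVirtuallyCyclic (G i)) →
      ∀ A : Finset (Monoid.CoprodI G),
        ¬ Group.IsVirtuallyCyclic (Subgroup.closure (A : Set (Monoid.CoprodI G))) →
          ((A ^ 3).card : ℝ) ≥ (1 / 7776 : ℝ) * (A.card : ℝ) ^ 2) ∧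
    ((∀ i, Group.IsVirtuallyAbelian (G i)) →
      ∀ A : Finset (Monoid.CoprodI G),
        ¬ Group.IsVirtuallyAbelian (Subgroup.closure (A : Set (Monoid.CoprodI G))) →
          ((A ^ 3).card : ℝ) ≥ (1 / 7776 : ℝ) * (A.card : ℝ) ^ 2) ∧
    ((∀ i, Group.IsVirtuallyNilpotent (G i)) →
      ∀ A : Finset (Monoid.CoprodI G),
        ¬ Group.IsVirtuallyNilpotent (Subgroup.closure (A : Set (Monoid.CoprodI G))) →
          ((A ^ 3).card : ℝ) ≥ (1 / 7776 : ℝ) * (A.card : ℝ) ^ 2) := by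
  have key : ∀ A : Finset (Monoid.CoprodI G), A.card ^ 2 ≤ 7776 * (A ^ 3).card →
      ((A ^ 3).card : ℝ) ≥ (1 / 7776 : ℝ) * (A.card : ℝ) ^ 2 := by
    intro A hA
    have : (A.card : ℝ) ^ 2 ≤ 7776 * ((A ^ 3).card : ℝ) := by exact_mod_cast hA
    linarith
  refine ⟨fun hG A hA => key A ?_, fun hG A hA => key A ?_, fun hG A hA => key A ?_⟩ <;>
    rcases Monoid.CoprodI.card_sq_le_card_pow_three A with h | h | ⟨i, f, hf⟩
  · exact h
  · exact absurd h hA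
  · exact absurd ((hG i).of_injective hf) hA
  · exact h
  · exact absurd h.isVirtuallyAbelian hA
  · exact absurd ((hG i).of_injective hf) hA
  · exact h
  · exact absurd h.isVirtuallyAbelian.isVirtuallyNilpotent hA
  · exact absurd ((hG i).of_injective hf) hA
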